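/- All graphs are finite and simple. A graph is \emph{pseudo-outerplanar} if each of its blocks (maximal connected subgraphs without a cut vertex of their own) can be drawn in the plane so that its vertices are distinct points of a fixed circle, its edges are simple arcs inside the closed disk bounded by this circle that join their ends and pass through no other vertex, and each edge crosses at most one other edge (two distinct edges cross if their arcs share a point that is not a vertex). A \emph{$k$-total coloring} of a graph $G$ is an assignment of colors from a set of $k$ colors to the vertices and edges of $G$ such that any two adjacent vertices, any two distinct edges with a common end, and any vertex and edge incident with each other receive different colors. \textbf{Corollary.} Every pseudo-outerplanar graph with maximum degree $\Delta$ (for every $\Delta \ge 0$) admits a $(\Delta+2)$-total coloring; that is, the total coloring conjecture holds for all pseudo-outerplanar graphs. -/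

import Mathlib

namespace SimpleGraph

universe u v

/-- A total coloring of `G`: a coloring of all the vertices and edges of `G` in which adjacent
vertices, distinct edges with a common end, and a vertex and an edge incident with it always
receive different colors. -/
structure IsTotalColoring {V : Type u} (G : SimpleGraph V) {α : Type v}
    (c : V ⊕ G.edgeSet → α) : Prop where
  vertex_ne : ∀ x y : V, G.Adj x y → c (.inl x) ≠ c (.inl y)
  edge_ne : ∀ e f : G.edgeSet, e ≠ f → (∃ x : V, x ∈ e.1 ∧ x ∈ f.1) → c (.inr e) ≠ c (.inr f)
  incident_ne : ∀ (x : V) (e : G.edgeSet), x ∈ e.1 → c (.inl x) ≠ c (.inr e)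

/-- `G` has a total coloring from a set of `k` colors. -/
def TotalColorable {V : Type u} (G : SimpleGraph V) (k : ℕ) : Prop :=
  ∃ c : V ⊕ G.edgeSet → Fin k, G.IsTotalColoring c

/-- A subgraph that is (nonempty and) connected and has no cut vertex of its own. -/
def Subgraph.IsNonseparable {V : Type u} {G : SimpleGraph V} (H : G.Subgraph) : Prop :=
  H.Connected ∧ ∀ x ∈ H.verts, (H.deleteVerts {x}).Preconnected

/-- A block of `G`: a maximal connected subgraph without a cut vertex (so an isolated vertex,
a bridge with its ends, or a maximal 2-connected subgraph). -/
def Subgraph.IsBlock {V : Type u} {G : SimpleGraph V} (B : G.Subgraph) : Prop :=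
  Maximal Subgraph.IsNonseparable B

/-- A drawing of `G` in the closed unit disk of the plane: the vertices are distinct points of the
unit circle, every edge is a simple arc in the disk that joins its two ends, and no edge passes
through a vertex other than its ends. -/
structure DiskDrawing {V : Type u} (G : SimpleGraph V) where
  /-- the point that represents a vertex -/
  pos : V → ℂ
  /-- the point set of the arc that represents an edge -/
  arc : G.edgeSet → Set ℂ
  pos_injective : Function.Injective pos
  pos_mem_circle : ∀ x : V, pos x ∈ Metric.sphere (0 : ℂ) 1
  arc_simple : ∀ e : G.edgeSet, ∃ γ : unitInterval → ℂ, Continuous γ ∧ Function.Injective γ ∧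
    Set.range γ = arc e ∧ s(γ 0, γ 1) = Sym2.map pos e.1
  arc_subset_disk : ∀ e : G.edgeSet, arc e ⊆ Metric.closedBall (0 : ℂ) 1
  mem_of_pos_mem_arc : ∀ (e : G.edgeSet) (x : V), pos x ∈ arc e → x ∈ e.1

/-- Two distinct edges cross in a drawing if their arcs meet at a point that is not a vertex. -/
def DiskDrawing.Cross {V : Type u} {G : SimpleGraph V} (D : G.DiskDrawing)
    (e f : G.edgeSet) : Prop :=
  e ≠ f ∧ ∃ p ∈ D.arc e ∩ D.arc f, p ∉ Set.range D.pos

/-- `G` is pseudo-outerplanar: each block has a drawing with its vertices on a circle and its edges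
inside the disk of this circle in which every edge crosses at most one other edge. -/
def IsPseudoOuterplanar {V : Type u} (G : SimpleGraph V) : Prop :=
  ∀ B : G.Subgraph, B.IsBlock → ∃ D : B.coe.DiskDrawing,
    ∀ e f g : B.coe.edgeSet, D.Cross e f → D.Cross e g → f = g

end SimpleGraph

/-! Fix `G₀` and `Δ`, and argue by induction over subgraphs of `G₀` with all degrees at most `Δ`:
delete one edge, color the rest with `Δ + 2` colors, and extend.

If an edge `uv` satisfies `d(u) + d(v) ≤ Δ + 2` and `2 d(u) < Δ + 2`, greedy choice colors `uv` and
recolors `u` (`exists_coloring_of_low_degree`). This excludes degree 1, and degree 2 once `Δ ≥ 3`;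
`Δ = 2` is settled by recoloring one edge (`exists_coloring_of_degree_two`). For `Δ ≥ 3` every
non-isolated vertex then has degree at least 3, and `IsPseudoOuterplanar.exists_isCubicPair` yields
adjacent cubic vertices `b`, `c` with common neighbors `a`, `d`. If `Δ ≥ 5`, the edge `bc` is
greedily colorable; with 6 colors a Hall-type choice for `b`, `c`, `bc` works; with 5 colors the
whole configuration is recolored.

The cubic pair comes from the drawing. Chords with alternating ends must meet
(`exists_eq_of_alternating`), so a drawing reduces to a circular order in which each edge is crossed
at most once. In an end piece of the graph, take a minimal interval of this order that no edge
leaves from the inside. A degree-3 vertex in it forces a crossing, and by minimality the four ends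
of the crossing edges are consecutive; the middle two are the pair. -/

namespace SimpleGraph

/-! ### Curves in the disk with alternating ends meet. -/

section CrossingArcs

open Complex

theorem eq_of_exp_eq_const {k : ℝ → ℂ} (hk : Continuous k) {a : ℂ} (h : ∀ t, exp (k t) = a)
    (s t : ℝ) : k s = k t := by
  have := Complex.isCoveringMap_exp.eq_of_comp_eq hk (continuous_const (y := k t))
    (by funext x; exact Subtype.ext ((h x).trans (h t).symm)) t rfl
  exact congrFun this s

/-- Dividing by `a` moves `h` into the right half-plane, where the principal logarithm is
continuous; hence `g - log (h / a)` has constant exponential and is itself constant. -/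
theorem sub_eq_log_sub_log {g h : ℝ → ℂ} (hg : Continuous g) (hh : Continuous h)
    (hgh : ∀ t, exp (g t) = h t) {a : ℂ} (hpos : ∀ t, 0 < (h t / a).re) (s t : ℝ) :
    g s - g t = log (h s / a) - log (h t / a) := by
  have hne : ∀ t, h t / a ≠ 0 := fun t h0 => by simpa [h0] using hpos t
  have := eq_of_exp_eq_const (k := fun t => g t - log (h t / a)) (a := a)
    (hg.sub ((hh.div_const a).clog fun t => Or.inl (hpos t))) (fun t => by
      rw [exp_sub, exp_log (hne t), hgh, div_div_cancel₀]
      intro h0; exact hne t (by simp [h0])) s t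
  linear_combination this

theorem re_one_sub_pos {w : ℂ} (hw : ‖w‖ ≤ 1) (h1 : w ≠ 1) : 0 < (1 - w).re := by
  have hre := (re_le_norm w).trans hw
  rcases hre.lt_or_eq with h | h
  · simpa using h
  · exfalso
    apply h1
    have : normSq w ≤ 1 := by
      rw [normSq_eq_norm_sq]; nlinarith [norm_nonneg w]
    rw [normSq_apply, h] at this
    exact Complex.ext h (by simp only [one_im]; nlinarith [sq_nonneg w.im])

/-- This is the half-angle identity `1 - e^{iθ} = 2 sin(θ/2) e^{i(θ-π)/2}`. -/
theorem arg_one_sub_exp {θ : ℝ} (h0 : 0 < θ) (h1 : θ < 2 * Real.pi) :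
    arg (1 - exp (θ * I)) = (θ - Real.pi) / 2 := by
  have hs : 0 < 2 * Real.sin (θ / 2) := by
    have := Real.sin_pos_of_pos_of_lt_pi (x := θ / 2) (by linarith) (by linarith)
    linarith
  have : 1 - exp (θ * I) = ((2 * Real.sin (θ / 2) : ℝ) : ℂ) *
      (cos (((θ - Real.pi) / 2 : ℝ) : ℂ) + sin (((θ - Real.pi) / 2 : ℝ) : ℂ) * I) := by
    have e1 : Real.cos ((θ - Real.pi) / 2) = Real.sin (θ / 2) := by
      rw [show (θ - Real.pi) / 2 = θ / 2 - Real.pi / 2 by ring, Real.cos_sub_pi_div_two]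
    have e2 : Real.sin ((θ - Real.pi) / 2) = - Real.cos (θ / 2) := by
      rw [show (θ - Real.pi) / 2 = θ / 2 - Real.pi / 2 by ring, Real.sin_sub_pi_div_two]
    rw [← ofReal_cos, ← ofReal_sin, e1, e2, exp_mul_I, ← ofReal_cos, ← ofReal_sin]
    have c1 : Real.cos θ = 1 - 2 * Real.sin (θ / 2) ^ 2 := by
      have := Real.cos_two_mul (θ / 2)
      rw [Real.cos_sq', mul_div_cancel₀ _ (two_ne_zero)] at this
      linarith
    have c2 : Real.sin θ = 2 * Real.sin (θ / 2) * Real.cos (θ / 2) := by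
      have := Real.sin_two_mul (θ / 2)
      rwa [mul_div_cancel₀ _ (two_ne_zero)] at this
    rw [c1, c2]; push_cast; ring
  rw [this, arg_real_mul _ hs, arg_cos_add_sin_mul_I]
  constructor <;> linarith [Real.pi_pos]

theorem arg_one_sub_exp_of_neg {θ : ℝ} (h0 : θ < 0) (h1 : -(2 * Real.pi) < θ) :
    arg (1 - exp (θ * I)) = (θ + Real.pi) / 2 := by
  have := arg_one_sub_exp (θ := θ + 2 * Real.pi) (by linarith) (by linarith)
  rw [show ((θ + 2 * Real.pi : ℝ) : ℂ) * I = θ * I + 2 * Real.pi * I by push_cast; ring,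
    exp_periodic] at this
  rw [this]; ring

theorem log_one_sub_im_sub {α β : ℝ} (hα : 0 ≤ α) (hαβ : α < β) (hβ : β < 2 * Real.pi) :
    (log (1 - exp (β * I) / exp (α * I))).im - (log (1 - exp (α * I) / exp (β * I))).im
      = β - α - Real.pi := by
  rw [log_im, log_im, ← exp_sub, ← exp_sub, ← sub_mul, ← sub_mul, ← ofReal_sub, ← ofReal_sub,
    arg_one_sub_exp (by linarith) (by linarith), arg_one_sub_exp_of_neg (by linarith) (by linarith)]
  ring

theorem exists_continuous_log {A : Type*} [TopologicalSpace A] [SimplyConnectedSpace A]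
    [LocallyPathConnectedSpace A] {F : A → ℂ} (hF : Continuous F) (h0 : ∀ x, F x ≠ 0) :
    ∃ g : A → ℂ, Continuous g ∧ ∀ x, exp (g x) = F x := by
  obtain ⟨a⟩ : Nonempty A := inferInstance
  obtain ⟨f, ⟨-, hf⟩, -⟩ := Complex.isCoveringMapOn_exp.existsUnique_continuousMap_lifts
    ⟨F, hF⟩ (exp_log (h0 a)) (fun x => h0 x)
  exact ⟨f, f.continuous, fun x => congrFun hf x⟩

/-- Two curves in the unit disk whose ends on the unit circle alternate have a common point. -/
theorem exists_eq_of_alternating {γ δ : ℝ → ℂ} (hγ : Continuous γ) (hδ : Continuous δ)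
    (hγb : ∀ s, ‖γ s‖ ≤ 1) (hδb : ∀ t, ‖δ t‖ ≤ 1) {p q x y : ℝ}
    (hp : 0 ≤ p) (hy : 0 ≤ y) (hq2 : q < 2 * Real.pi) (hy2 : y < 2 * Real.pi)
    (hpx : p < x) (hxq : x < q) (hyo : y < p ∨ q < y)
    (hγ0 : γ 0 = exp (p * I)) (hγ1 : γ 1 = exp (q * I)) (hδ0 : δ 0 = exp (x * I))
    (hδ1 : δ 1 = exp (y * I)) : ∃ s t, γ s = δ t := by
  by_contra! hne
  -- If the curves were disjoint, `γ s - δ t` would have a continuous logarithm on the plane, so its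
  -- increments around the unit square would cancel. On each side of the square one curve rests at a
  -- point of the circle, which makes the increment computable by principal logarithms.
  obtain ⟨g, hg, hgF⟩ := exists_continuous_log (A := ℝ × ℝ) (F := fun z => γ z.1 - δ z.2)
    (by fun_prop) (fun z => sub_ne_zero.2 (hne _ _))
  have pos : ∀ (θ : ℝ) (w : ℂ), ‖w‖ ≤ 1 → w ≠ exp (θ * I) → 0 < (1 - w / exp (θ * I)).re := by
    intro θ w hw hwe
    apply re_one_sub_pos
    · simpa [norm_exp_ofReal_mul_I] using hw
    · intro h; exact hwe ((div_eq_one_iff_eq (exp_ne_zero _)).1 h)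
  have divl : ∀ (θ : ℝ) (w : ℂ), (exp (θ * I) - w) / exp (θ * I) = 1 - w / exp (θ * I) := by
    intro θ w; rw [sub_div, div_self (exp_ne_zero _)]
  have divr : ∀ (θ : ℝ) (w : ℂ), (w - exp (θ * I)) / -exp (θ * I) = 1 - w / exp (θ * I) := by
    intro θ w; rw [div_neg, sub_div, div_self (exp_ne_zero _)]; ring
  have left := sub_eq_log_sub_log (g := fun t => g (0, t)) (h := fun t => exp (p * I) - δ t)
    (by fun_prop) (by fun_prop) (fun t => by rw [hgF, hγ0])
    (fun t => by rw [divl]; exact pos _ _ (hδb t) (hγ0 ▸ (hne 0 t).symm)) 1 0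
  have right := sub_eq_log_sub_log (g := fun t => g (1, t)) (h := fun t => exp (q * I) - δ t)
    (by fun_prop) (by fun_prop) (fun t => by rw [hgF, hγ1])
    (fun t => by rw [divl]; exact pos _ _ (hδb t) (hγ1 ▸ (hne 1 t).symm)) 1 0
  have bot := sub_eq_log_sub_log (g := fun s => g (s, 0)) (h := fun s => γ s - exp (x * I))
    (by fun_prop) (by fun_prop) (fun s => by rw [hgF, hδ0])
    (fun s => by rw [divr]; exact pos _ _ (hγb s) (hδ0 ▸ hne s 0)) 1 0
  have top := sub_eq_log_sub_log (g := fun s => g (s, 1)) (h := fun s => γ s - exp (y * I))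
    (by fun_prop) (by fun_prop) (fun s => by rw [hgF, hδ1])
    (fun s => by rw [divr]; exact pos _ _ (hγb s) (hδ1 ▸ hne s 1)) 1 0
  simp only [divl, divr, hγ0, hγ1, hδ0, hδ1] at left right bot top
  have key := congrArg im (show _ = _ by linear_combination left + top - right - bot :
    (0 : ℂ) = log (1 - exp (y * I) / exp (p * I)) - log (1 - exp (x * I) / exp (p * I))
      + (log (1 - exp (q * I) / exp (y * I)) - log (1 - exp (p * I) / exp (y * I)))
      - (log (1 - exp (y * I) / exp (q * I)) - log (1 - exp (x * I) / exp (q * I)))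
      - (log (1 - exp (q * I) / exp (x * I)) - log (1 - exp (p * I) / exp (x * I))))
  simp only [add_im, sub_im, zero_im] at key
  have h1 := log_one_sub_im_sub hp hpx (by linarith)
  have h2 := log_one_sub_im_sub (hp.trans hpx.le) hxq hq2
  have hpi := Real.pi_pos
  -- In either position of `y` the eight arguments add up to `2π`, not `0`.
  rcases hyo with h | h
  · have h3 := log_one_sub_im_sub hy h (by linarith)
    have h4 := log_one_sub_im_sub hy (h.trans (hpx.trans hxq)) hq2
    linarith
  · have h3 := log_one_sub_im_sub hp ((hpx.trans hxq).trans h) hy2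
    have h4 := log_one_sub_im_sub (by linarith) h hy2
    linarith

end CrossingArcs

/-! ### From a drawing to a circular order. -/

section CircularOrder

variable {V : Type*} {G : SimpleGraph V}

/-- The point `x` lies strictly between `p` and `q`, and `y` lies outside the closed interval from
`p` to `q`, with respect to the positions `f`. -/
def Separates (f : V → ℝ) (p q x y : V) : Prop :=
  (f p < f x ∧ f x < f q) ∧ (f y < f p ∨ f q < f y)

theorem exists_angle {w : ℂ} (hw : ‖w‖ = 1) :
    ∃ θ : ℝ, 0 ≤ θ ∧ θ < 2 * Real.pi ∧ Complex.exp (θ * Complex.I) = w := by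
  have h := Complex.norm_mul_exp_arg_mul_I w
  rw [hw, Complex.ofReal_one, one_mul] at h
  rcases le_or_gt 0 (Complex.arg w) with h0 | h0
  · exact ⟨_, h0, by linarith [Complex.arg_le_pi w, Real.pi_pos], h⟩
  · refine ⟨Complex.arg w + 2 * Real.pi, by linarith [Complex.neg_pi_lt_arg w, Real.pi_pos],
      by linarith, ?_⟩
    rw [show ((Complex.arg w + 2 * Real.pi : ℝ) : ℂ) * Complex.I
      = Complex.arg w * Complex.I + 2 * Real.pi * Complex.I by push_cast; ring,
      Complex.exp_periodic, h]

theorem DiskDrawing.exists_curve (D : G.DiskDrawing) {x y : V} (h : G.Adj x y) :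
    ∃ γ : ℝ → ℂ, Continuous γ ∧ γ 0 = D.pos x ∧ γ 1 = D.pos y ∧
      ∀ t, γ t ∈ D.arc ⟨s(x, y), h⟩ := by
  obtain ⟨γ, hc, -, hr, he⟩ := D.arc_simple ⟨s(x, y), h⟩
  rw [Sym2.map_mk, Sym2.eq_iff] at he
  rcases he with ⟨h0, h1⟩ | ⟨h0, h1⟩
  · exact ⟨Set.IccExtend zero_le_one γ, hc.Icc_extend', by
      rw [Set.IccExtend_left]; exact h0, by rw [Set.IccExtend_right]; exact h1,
      fun t => hr ▸ Set.mem_range_self _⟩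
  · refine ⟨Set.IccExtend zero_le_one (γ ∘ unitInterval.symm),
      (hc.comp unitInterval.continuous_symm).Icc_extend', ?_, ?_,
      fun t => hr ▸ Set.mem_range_self (f := γ) _⟩
    · rw [Set.IccExtend_left]
      exact (congrArg γ unitInterval.symm_zero).trans h1
    · rw [Set.IccExtend_right]
      exact (congrArg γ unitInterval.symm_one).trans h0

/-- Reading off the angles from a drawing, starting at any vertex. -/
theorem DiskDrawing.exists_order (D : G.DiskDrawing) (z : V) :
    ∃ f : V → ℝ, Function.Injective f ∧ (∀ v, f z ≤ f v) ∧
      ∀ (p q x y : V) (hpq : G.Adj p q) (hxy : G.Adj x y), Separates f p q x y →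
        D.Cross ⟨s(p, q), hpq⟩ ⟨s(x, y), hxy⟩ := by
  have hn : ∀ v, ‖D.pos v‖ = 1 := fun v => by simpa using D.pos_mem_circle v
  have hz : D.pos z ≠ 0 := fun h => by simpa [h] using hn z
  -- Division by `D.pos z` rotates the circle so that `z` gets angle `0`, the least one.
  choose f hf0 hf2 hfe using fun v => exists_angle (w := D.pos v / D.pos z) (by simp [hn])
  have hinj : Function.Injective f := fun v w h => by
    apply D.pos_injective
    have := (hfe v).symm.trans ((congrArg _ (by rw [h])).trans (hfe w))
    exact (div_left_inj' hz).1 this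
  refine ⟨f, hinj, fun v => ?_, ?_⟩
  · have h1 := hfe z
    rw [div_self hz] at h1
    suffices f z = 0 by rw [this]; exact hf0 v
    by_contra hne
    have h3 := arg_one_sub_exp (lt_of_le_of_ne (hf0 z) (Ne.symm hne)) (hf2 z)
    obtain ⟨n, hn⟩ := Complex.exp_eq_one_iff.1 h1
    have h4 : f z = n * (2 * Real.pi) := by
      have := congrArg Complex.im hn
      simpa using this
    have h5 : (0 : ℝ) < n := by
      by_contra! h
      have := lt_of_le_of_ne (hf0 z) (Ne.symm hne)
      nlinarith [Real.pi_pos]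
    have h6 : (1 : ℝ) ≤ n := by
      have : (0 : ℤ) < n := by exact_mod_cast h5
      exact_mod_cast this
    nlinarith [Real.pi_pos, hf2 z]
  · intro p q x y hpq hxy hsep
    obtain ⟨⟨h1, h2⟩, h3⟩ := hsep
    have hmem : ∀ v : V, v ∈ s(p, q) → v ∈ s(x, y) → False := by
      intro v hv hv'
      rw [Sym2.mem_iff] at hv hv'
      rcases hv with rfl | rfl <;> rcases hv' with rfl | rfl <;>
        rcases h3 with h3 | h3 <;> linarith
    refine ⟨fun h => hmem p (Sym2.mem_mk_left _ _) ?_, ?_⟩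
    · have := congrArg Subtype.val h
      simp only at this
      rw [← this]; exact Sym2.mem_mk_left _ _
    obtain ⟨γ, hγ, hγ0, hγ1, hγa⟩ := D.exists_curve hpq
    obtain ⟨δ, hδ, hδ0, hδ1, hδa⟩ := D.exists_curve hxy
    have hb : ∀ e : G.edgeSet, ∀ w ∈ D.arc e, ‖w / D.pos z‖ ≤ 1 := by
      intro e w hw
      have := D.arc_subset_disk e hw
      simpa [hn] using this
    obtain ⟨s, t, hst⟩ := exists_eq_of_alternating (γ := fun s => γ s / D.pos z)
      (δ := fun s => δ s / D.pos z) (hγ.div_const _) (hδ.div_const _)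
      (fun s => hb _ _ (hγa s)) (fun s => hb _ _ (hδa s)) (hf0 p) (hf0 y) (hf2 q) (hf2 y) h1 h2 h3
      (by rw [hγ0, hfe]) (by rw [hγ1, hfe]) (by rw [hδ0, hfe]) (by rw [hδ1, hfe])
    have hst' : γ s = δ t := (div_left_inj' hz).1 hst
    refine ⟨γ s, ⟨hγa s, hst' ▸ hδa t⟩, ?_⟩
    rintro ⟨v, hv⟩
    exact hmem v (D.mem_of_pos_mem_arc ⟨s(p, q), hpq⟩ v (hv ▸ hγa s))
      (D.mem_of_pos_mem_arc ⟨s(x, y), hxy⟩ v (by rw [hv, hst']; exact hδa t))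

end CircularOrder

/-! ### End pieces of the graph and their orders. -/

section Structure

variable {V : Type*} {G : SimpleGraph V}

theorem Subgraph.preconnected_of_closed {H : G.Subgraph} {v : V} (hv : v ∈ H.verts)
    (h : ∀ T : Set V, v ∈ T → (∀ x ∈ T, ∀ y, H.Adj x y → y ∈ T) → H.verts ⊆ T) :
    H.Preconnected := by
  have key : ∀ w : H.verts, H.coe.Reachable ⟨v, hv⟩ w := by
    rintro ⟨w, hw⟩
    obtain ⟨_, h'⟩ := h {w | ∃ h : w ∈ H.verts, H.coe.Reachable ⟨v, hv⟩ ⟨w, h⟩} ⟨hv, .refl _⟩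
      (by
        rintro x ⟨hx, hr⟩ y hxy
        exact ⟨H.edge_vert hxy.symm, hr.trans (Adj.reachable hxy.coe)⟩) hw
    exact h'
  exact ⟨fun x y => (key x).symm.trans (key y)⟩

/-- `G` restricted to `S`, as a subgraph of a larger graph. -/
def Subgraph.ofLE {G₀ : SimpleGraph V} (hle : G ≤ G₀) (S : Set V) : G₀.Subgraph where
  verts := S
  Adj x y := x ∈ S ∧ y ∈ S ∧ G.Adj x y
  adj_sub h := hle h.2.2
  edge_vert h := h.1
  symm := ⟨fun _ _ h => ⟨h.2.1, h.1, h.2.2.symm⟩⟩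

/-- A nonempty set `C` of vertices, none of them isolated, that `z` separates from the rest. -/
structure IsHanging (G : SimpleGraph V) (z : V) (C : Set V) : Prop where
  nonempty : C.Nonempty
  notMem : z ∉ C
  closed : ∀ x ∈ C, ∀ y, G.Adj x y → y = z ∨ y ∈ C
  exists_adj : ∀ x ∈ C, ∃ y, G.Adj x y

theorem exists_minimal_isHanging [Finite V] {u v : V} (huv : G.Adj u v) :
    ∃ z C, G.IsHanging z C ∧ ∀ z' C', G.IsHanging z' C' → C' ⊆ C → C' = C := by
  have h0 : ∃ C, ∃ z, G.IsHanging z C :=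
    ⟨{x | x ≠ u ∧ ∃ y, G.Adj x y}, u, ⟨v, huv.ne', u, huv.symm⟩, fun h => h.1 rfl,
      fun x _ y hxy => or_iff_not_imp_left.2 fun hy => ⟨hy, x, hxy.symm⟩, fun x hx => hx.2⟩
  obtain ⟨C₀, hC₀⟩ := h0
  obtain ⟨C, -, hC⟩ := Finite.exists_le_minimal (p := fun C => ∃ z, G.IsHanging z C) hC₀
  obtain ⟨z, hz⟩ := hC.1
  exact ⟨z, C, hz, fun z' C' h h' => hC.eq_of_le ⟨z', h⟩ h'⟩

/-- A minimal hanging set together with `z` is an end block: a cut vertex would split off a smaller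
hanging set. It is stated inside `G₀` so that it can be placed in a block of `G₀`. -/
theorem IsHanging.isNonseparable {G₀ : SimpleGraph V} (hle : G ≤ G₀) {z : V} {C : Set V}
    (h : G.IsHanging z C) (hmin : ∀ z' C', G.IsHanging z' C' → C' ⊆ C → C' = C)
    (hdeg : ∀ x ∈ C, ∃ y, G.Adj x y ∧ y ≠ z) :
    (Subgraph.ofLE hle (insert z C)).IsNonseparable := by
  have key : ∀ x ∈ C, ∀ T : Set V, z ∈ T →
      (∀ a ∈ T, ∀ b ∈ insert z C, b ≠ x → G.Adj a b → b ∈ T) → ∀ y ∈ C, y ≠ x → y ∈ T := by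
    intro x hx T hzT hT y hy hyx
    by_contra hyT
    -- Whatever cannot be reached from `z` without `x` hangs at `x`; by minimality it would be all
    -- of `C`, yet it omits `x`.
    have hh : G.IsHanging x {w | w ∈ C ∧ w ≠ x ∧ w ∉ T} := by
      refine ⟨⟨y, hy, hyx, hyT⟩, fun h => h.2.1 rfl, ?_, fun w hw => h.exists_adj w hw.1⟩
      rintro a ⟨haC, hax, haT⟩ b hab
      refine or_iff_not_imp_left.2 fun hbx => ?_
      have hbT : b ∉ T := fun hb =>
        haT (hT b hb a (Set.mem_insert_of_mem _ haC) hax hab.symm)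
      refine ⟨(h.closed a haC b hab).resolve_left ?_, hbx, hbT⟩
      rintro rfl; exact hbT hzT
    have := hmin _ _ hh (fun w hw => hw.1)
    exact (this.ge hx).2.1 rfl
  refine ⟨Subgraph.connected_iff.2 ⟨?_, ⟨z, Set.mem_insert _ _⟩⟩, ?_⟩
  · refine Subgraph.preconnected_of_closed (Set.mem_insert z C) fun T hzT hT => ?_
    have hT' : ∀ a ∈ T, ∀ b ∈ insert z C, a ∈ insert z C → G.Adj a b → b ∈ T :=
      fun a ha b hb ha' hab => hT a ha b ⟨ha', hb, hab⟩
    rintro y (rfl | hy)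
    · exact hzT
    obtain ⟨x, hyx, hxz⟩ := hdeg y hy
    have hx := (h.closed y hy x hyx).resolve_left hxz
    -- `y` is joined to `z` even after removing its neighbor `x`; the neighbor only serves as a
    -- vertex of `C` other than `y` to which `key` applies.
    refine (key x hx (T ∩ insert z C) ⟨hzT, Set.mem_insert _ _⟩ ?_ y hy hyx.ne).1
    exact fun a ha b hb _ hab => ⟨hT' a ha.1 b hb ha.2 hab, hb⟩
  · rintro x (rfl | hx)
    · obtain ⟨v, hv⟩ := h.nonempty
      refine Subgraph.preconnected_of_closed (v := v)
        ⟨Set.mem_insert_of_mem _ hv, fun hvx => h.notMem (hvx ▸ hv)⟩ fun T hvT hT => ?_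
      have hh : G.IsHanging x (C ∩ T) := by
        refine ⟨⟨v, hv, hvT⟩, fun h' => h.notMem h'.1, ?_, fun w hw => h.exists_adj w hw.1⟩
        rintro a ⟨haC, haT⟩ b hab
        refine or_iff_not_imp_left.2 fun hbx => ?_
        have hbC := (h.closed a haC b hab).resolve_left hbx
        refine ⟨hbC, hT a haT b ?_⟩
        exact Subgraph.deleteVerts_adj.2 ⟨Set.mem_insert_of_mem _ haC,
          fun h' => h.notMem (h' ▸ haC), Set.mem_insert_of_mem _ hbC, hbx,
          Set.mem_insert_of_mem _ haC, Set.mem_insert_of_mem _ hbC, hab⟩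
      have := hmin _ _ hh Set.inter_subset_left
      rintro y ⟨hy, hyx⟩
      have hyC : y ∈ C := hy.resolve_left hyx
      exact (this.ge hyC).2
    · have hzx : z ≠ x := fun h' => h.notMem (h' ▸ hx)
      refine Subgraph.preconnected_of_closed (v := z) ⟨Set.mem_insert _ _, hzx⟩
        fun T hzT hT => ?_
      rintro y ⟨rfl | hy, hyx⟩
      · exact hzT
      refine (key x hx (T ∩ {w | w ∈ insert z C ∧ w ≠ x}) ⟨hzT, Set.mem_insert _ _, hzx⟩ ?_
        y hy hyx).1
      rintro a ⟨haT, haC, hax⟩ b hb hbx hab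
      exact ⟨hT a haT b (Subgraph.deleteVerts_adj.2 ⟨haC, hax, hb, hbx, haC, hb, hab⟩), hb, hbx⟩

/-- With respect to the positions `f`, the ends of every edge of `G` in `S` are separated by those of
at most one other edge in `S`. -/
def AtMostOneCrossing (G : SimpleGraph V) (S : Set V) (f : V → ℝ) : Prop :=
  ∀ p ∈ S, ∀ q ∈ S, ∀ x ∈ S, ∀ y ∈ S, ∀ x' ∈ S, ∀ y' ∈ S, G.Adj p q → G.Adj x y → G.Adj x' y' →
    Separates f p q x y → Separates f p q x' y' → s(x, y) = s(x', y')

theorem IsPseudoOuterplanar.exists_order [Finite V] {G₀ : SimpleGraph V}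
    (hG : G₀.IsPseudoOuterplanar) (hle : G ≤ G₀) {S : Set V} {z : V} (hz : z ∈ S)
    (hS : (Subgraph.ofLE hle S).IsNonseparable) :
    ∃ f : V → ℝ, Set.InjOn f S ∧ (∀ v ∈ S, f z ≤ f v) ∧ G.AtMostOneCrossing S f := by
  classical
  obtain ⟨B, hSB, hB⟩ := Finite.exists_le_maximal (p := Subgraph.IsNonseparable) hS
  obtain ⟨D, hD⟩ := hG B hB
  have hv : ∀ v ∈ S, v ∈ B.verts := fun v h => hSB.1 h
  obtain ⟨f, hf, hfz, hfc⟩ := D.exists_order ⟨z, hv z hz⟩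
  -- The value `0` off the block is never used, since `S` lies inside `B.verts`.
  let F : V → ℝ := fun v => if h : v ∈ B.verts then f ⟨v, h⟩ else 0
  have hF : ∀ v : V, ∀ h : v ∈ B.verts, F v = f ⟨v, h⟩ := fun v h => dif_pos h
  refine ⟨F, ?_, ?_, ?_⟩
  · intro v hvS w hwS h
    rw [hF v (hv v hvS), hF w (hv w hwS)] at h
    exact congrArg Subtype.val (hf h)
  · intro v hvS
    rw [hF v (hv v hvS), hF z (hv z hz)]
    exact hfz _
  · intro p hp q hq x hx y hy x' hx' y' hy' hpq hxy hxy' h1 h2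
    simp only [Separates, hF _ (hv _ hp), hF _ (hv _ hq), hF _ (hv _ hx), hF _ (hv _ hy),
      hF _ (hv _ hx'), hF _ (hv _ hy')] at h1 h2
    have a1 : B.coe.Adj ⟨p, hv p hp⟩ ⟨q, hv q hq⟩ := hSB.2 ⟨hp, hq, hpq⟩
    have a2 : B.coe.Adj ⟨x, hv x hx⟩ ⟨y, hv y hy⟩ := hSB.2 ⟨hx, hy, hxy⟩
    have a3 : B.coe.Adj ⟨x', hv x' hx'⟩ ⟨y', hv y' hy'⟩ := hSB.2 ⟨hx', hy', hxy'⟩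
    have := congrArg Subtype.val
      (hD _ _ _ (hfc _ _ _ _ a1 a2 h1) (hfc _ _ _ _ a1 a3 h2))
    simpa using congrArg (Sym2.map Subtype.val) this

end Structure

/-! ### A crossing inside a minimal interval gives a cubic pair. -/

section Interval

variable {V : Type*} {G : SimpleGraph V} {S : Set V} {f : V → ℝ}

/-- The points of `S` strictly between `i` and `j`. -/
def betweenPoints (S : Set V) (f : V → ℝ) (i j : V) : Set V := {x | x ∈ S ∧ f i < f x ∧ f x < f j}

/-- No edge leaves the interval from `i` to `j` from one of its interior points. -/
def ClosedInterval (G : SimpleGraph V) (S : Set V) (f : V → ℝ) (i j : V) : Prop :=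
  ∀ x ∈ betweenPoints S f i j, ∀ y, G.Adj x y → y ∈ S ∧ f i ≤ f y ∧ f y ≤ f j

/-- The edges `pq` and `rs` cross each other and therefore nothing else. Any edge leaving one of the
four intervals from its inside would be a further crossing with one of them. -/
theorem AtMostOneCrossing.closedInterval (h : G.AtMostOneCrossing S f)
    {i j p q r s : V} (hp : p ∈ S) (hq : q ∈ S) (hr : r ∈ S) (hs : s ∈ S) (hpq : G.Adj p q)
    (hrs : G.Adj r s) (hij : G.ClosedInterval S f i j) (hip : f i ≤ f p) (hsj : f s ≤ f j)
    (hpr : f p < f r) (hrq : f r < f q) (hqs : f q < f s) :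
    G.ClosedInterval S f p r ∧ G.ClosedInterval S f r q ∧ G.ClosedInterval S f q s ∧
      G.ClosedInterval S f p s := by
  have hA : ∀ x ∈ S, ∀ y ∈ S, G.Adj x y → f p < f x → f x < f q → (f y < f p ∨ f q < f y) →
      f x = f r ∧ f y = f s := by
    intro x hx y hy hxy h1 h2 h3
    have := h p hp q hq x hx y hy r hr s hs hpq hxy hrs ⟨⟨h1, h2⟩, h3⟩ ⟨⟨hpr, hrq⟩, .inr hqs⟩
    rcases Sym2.eq_iff.1 this with ⟨rfl, rfl⟩ | ⟨rfl, rfl⟩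
    · exact ⟨rfl, rfl⟩
    · linarith
  have hB : ∀ x ∈ S, ∀ y ∈ S, G.Adj x y → f r < f x → f x < f s → (f y < f r ∨ f s < f y) →
      f x = f q ∧ f y = f p := by
    intro x hx y hy hxy h1 h2 h3
    have := h r hr s hs x hx y hy q hq p hp hrs hxy hpq.symm ⟨⟨h1, h2⟩, h3⟩
      ⟨⟨hrq, hqs⟩, .inl hpr⟩
    rcases Sym2.eq_iff.1 this with ⟨rfl, rfl⟩ | ⟨rfl, rfl⟩
    · exact ⟨rfl, rfl⟩
    · linarith
  have hin : ∀ x ∈ S, f p < f x → f x < f s → ∀ y, G.Adj x y → y ∈ S := fun x hx h1 h2 y hxy =>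
    (hij x ⟨hx, by linarith, by linarith⟩ y hxy).1
  refine ⟨?_, ?_, ?_, ?_⟩
  · rintro x ⟨hx, h1, h2⟩ y hxy
    have hy := hin x hx h1 (by linarith) y hxy
    refine ⟨hy, ?_, ?_⟩ <;> by_contra! h3
    · linarith [(hA x hx y hy hxy h1 (by linarith) (.inl h3)).1]
    · rcases lt_or_ge (f q) (f y) with h4 | h4
      · linarith [(hA x hx y hy hxy h1 (by linarith) (.inr h4)).1]
      · linarith [(hB y hy x hx hxy.symm h3 (by linarith) (.inl h2)).2]
  · rintro x ⟨hx, h1, h2⟩ y hxy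
    have hy := hin x hx (by linarith) (by linarith) y hxy
    refine ⟨hy, ?_, ?_⟩ <;> by_contra! h3
    · linarith [(hB x hx y hy hxy h1 (by linarith) (.inl h3)).1]
    · linarith [(hA x hx y hy hxy (by linarith) h2 (.inr h3)).1]
  · rintro x ⟨hx, h1, h2⟩ y hxy
    have hy := hin x hx (by linarith) h2 y hxy
    refine ⟨hy, ?_, ?_⟩ <;> by_contra! h3
    · rcases lt_or_ge (f y) (f r) with h4 | h4
      · linarith [(hB x hx y hy hxy (by linarith) h2 (.inl h4)).1]
      · linarith [(hA y hy x hx hxy.symm (by linarith) h3 (.inr h1)).2]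
    · linarith [(hB x hx y hy hxy (by linarith) h2 (.inr h3)).1]
  · rintro x ⟨hx, h1, h2⟩ y hxy
    have hy := hin x hx h1 h2 y hxy
    refine ⟨hy, ?_, ?_⟩ <;> by_contra! h3
    · rcases lt_or_ge (f x) (f q) with h4 | h4
      · linarith [(hA x hx y hy hxy h1 h4 (.inl h3)).2]
      · linarith [(hB x hx y hy hxy (by linarith) h2 (.inl (by linarith))).2]
    · rcases lt_or_ge (f r) (f x) with h4 | h4
      · linarith [(hB x hx y hy hxy h4 h2 (.inr h3)).2]
      · linarith [(hA x hx y hy hxy h1 (by linarith) (.inr (by linarith))).2]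

/-- Adjacent vertices `b` and `c` of degree three with the common neighbors `a` and `d`. -/
structure IsCubicPair (G : SimpleGraph V) (a b c d : V) : Prop where
  ne : a ≠ d
  adj_left : ∀ y, G.Adj b y ↔ y = a ∨ y = c ∨ y = d
  adj_right : ∀ y, G.Adj c y ↔ y = a ∨ y = b ∨ y = d

theorem eq_of_three_distinct {P : V → Prop} {a b c y₁ y₂ y₃ : V}
    (hP : ∀ y, P y → y = a ∨ y = b ∨ y = c) (h₁ : P y₁) (h₂ : P y₂) (h₃ : P y₃)
    (h12 : y₁ ≠ y₂) (h13 : y₁ ≠ y₃) (h23 : y₂ ≠ y₃) (y : V) : P y ↔ y = a ∨ y = b ∨ y = c := by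
  refine ⟨hP y, ?_⟩
  have e1 := hP _ h₁
  have e2 := hP _ h₂
  have e3 := hP _ h₃
  grind

/-- In a minimal nonempty closed interval, an interior vertex has two neighbors on one side. The
longer of these two edges spans a proper subinterval with a point inside, which cannot be closed, so
some edge crosses it. The intervals cut out by this crossing are closed, hence empty. -/
theorem AtMostOneCrossing.exists_isCubicPair [Finite V] (h : G.AtMostOneCrossing S f)
    (hf : Set.InjOn f S) {i₀ j₀ : V} (hi₀ : i₀ ∈ S) (hj₀ : j₀ ∈ S)
    (hcl : G.ClosedInterval S f i₀ j₀) (hne : (betweenPoints S f i₀ j₀).Nonempty)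
    (hdeg : ∀ x ∈ betweenPoints S f i₀ j₀, ∃ y₁ y₂ y₃, G.Adj x y₁ ∧ G.Adj x y₂ ∧ G.Adj x y₃ ∧
      y₁ ≠ y₂ ∧ y₁ ≠ y₃ ∧ y₂ ≠ y₃) :
    ∃ a b c d, G.IsCubicPair a b c d := by
  obtain ⟨T, hTle, ⟨⟨i, hi, j, hj, rfl, hij⟩, hTne⟩, hTmin⟩ := Finite.exists_le_minimal
    (p := fun T => (∃ i ∈ S, ∃ j ∈ S, T = betweenPoints S f i j ∧ G.ClosedInterval S f i j) ∧
      T.Nonempty)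
    ⟨⟨i₀, hi₀, j₀, hj₀, rfl, hcl⟩, hne⟩
  have hmin : ∀ p ∈ S, ∀ q ∈ S, G.ClosedInterval S f p q → f i ≤ f p → f q ≤ f j →
      (betweenPoints S f p q).Nonempty → p = i ∧ q = j := by
    intro p hp q hq hpq hip hqj hpqne
    have hle := hTmin ⟨⟨p, hp, q, hq, rfl, hpq⟩, hpqne⟩
      (fun x hx => ⟨hx.1, by linarith [hx.2.1], by linarith [hx.2.2]⟩)
    obtain ⟨x, hx⟩ := hpqne
    constructor
    · apply hf hp hi
      refine le_antisymm ?_ hip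
      by_contra! hlt
      exact (hle (⟨hp, hlt, by linarith [hx.2.1, hx.2.2]⟩ : p ∈ betweenPoints S f i j)).2.1.false
    · apply hf hq hj
      refine le_antisymm hqj ?_
      by_contra! hlt
      exact (hle (⟨hq, by linarith [hx.2.1, hx.2.2], hlt⟩ : q ∈ betweenPoints S f i j)).2.2.false
  have hdeg' := fun x hx => hdeg x (hTle hx)
  -- the case of two crossing edges
  have cross : ∀ p ∈ S, ∀ q ∈ S, ∀ r ∈ S, ∀ s ∈ S, G.Adj p q → G.Adj r s → f i ≤ f p → f s ≤ f j →
      f p < f r → f r < f q → f q < f s → ∃ a b c d, G.IsCubicPair a b c d := by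
    intro p hp q hq r hr s hs hpq hrs hip hsj hpr hrq hqs
    obtain ⟨c1, c2, c3, c4⟩ := h.closedInterval hp hq hr hs hpq hrs hij hip hsj hpr hrq hqs
    -- The four ends are consecutive: a point in a gap would make that gap a proper closed nonempty
    -- interval. Having three neighbors among `p`, `r`, `q`, `s`, each of `r` and `q` is then
    -- adjacent to all the others.
    have e : ∀ x ∈ S, f p ≤ f x → f x ≤ f s → x = p ∨ x = r ∨ x = q ∨ x = s := by
      intro x hx h1 h2
      by_contra! hcon
      obtain ⟨n1, n2, n3, n4⟩ := hcon
      have n1' : f p < f x := lt_of_le_of_ne h1 fun e => n1 (hf hp hx e).symm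
      have n4' : f x < f s := lt_of_le_of_ne h2 fun e => n4 (hf hx hs e)
      rcases lt_or_gt_of_ne (fun e => n2 (hf hx hr e)) with n2' | n2'
      · have := hmin p hp r hr c1 hip (by linarith) ⟨x, hx, n1', n2'⟩
        rw [this.2] at hrq; linarith
      rcases lt_or_gt_of_ne (fun e => n3 (hf hx hq e)) with n3' | n3'
      · have := hmin r hr q hq c2 (by linarith) (by linarith) ⟨x, hx, n2', n3'⟩
        rw [this.2] at hqs; linarith
      · have := hmin q hq s hs c3 (by linarith) hsj ⟨x, hx, n3', n4'⟩
        rw [this.1] at hrq; linarith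
    refine ⟨p, r, q, s, fun hps => by rw [hps] at hpr; linarith, ?_, ?_⟩
    · have hr' : r ∈ betweenPoints S f p s := ⟨hr, hpr, by linarith⟩
      obtain ⟨y₁, y₂, y₃, a1, a2, a3, h12, h13, h23⟩ :=
        hdeg' r ⟨hr, by linarith, by linarith⟩
      refine eq_of_three_distinct (fun y hy => ?_) a1 a2 a3 h12 h13 h23
      obtain ⟨hyS, h1, h2⟩ := c4 r hr' y hy
      have := e y hyS h1 h2
      have := hy.ne'
      tauto
    · have hq' : q ∈ betweenPoints S f p s := ⟨hq, by linarith, hqs⟩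
      obtain ⟨y₁, y₂, y₃, a1, a2, a3, h12, h13, h23⟩ :=
        hdeg' q ⟨hq, by linarith, by linarith⟩
      refine eq_of_three_distinct (fun y hy => ?_) a1 a2 a3 h12 h13 h23
      obtain ⟨hyS, h1, h2⟩ := c4 q hq' y hy
      have := e y hyS h1 h2
      have := hy.ne'
      tauto
  -- an edge that is not consecutive is crossed
  have long : ∀ p ∈ S, ∀ q ∈ S, G.Adj p q → f i ≤ f p → f q ≤ f j → (p ≠ i ∨ q ≠ j) →
      (betweenPoints S f p q).Nonempty → ∃ a b c d, G.IsCubicPair a b c d := by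
    intro p hp q hq hpq hip hqj hor hne
    have hncl : ¬ G.ClosedInterval S f p q := fun hc => by
      have := hmin p hp q hq hc hip hqj hne
      tauto
    simp only [ClosedInterval, not_forall] at hncl
    obtain ⟨x, ⟨hx, h1, h2⟩, y, hxy, hy⟩ := hncl
    obtain ⟨hyS, h3, h4⟩ := hij x ⟨hx, by linarith, by linarith⟩ y hxy
    rcases lt_or_ge (f y) (f p) with h5 | h5
    · exact cross y hyS x hx p hp q hq hxy.symm hpq h3 hqj h5 h1 h2
    · have h6 : f q < f y := by
        by_contra! h6
        exact hy ⟨hyS, h5, h6⟩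
      exact cross p hp q hq x hx y hyS hpq hxy hip h4 h1 h2 h6
  obtain ⟨x, hx⟩ := hTne
  have right : ∀ y y', G.Adj x y' → f x < f y → f y < f y' → y ∈ S →
      ∃ a b c d, G.IsCubicPair a b c d := by
    intro y y' h1 h2 h3 hy
    obtain ⟨hyS', -, h4⟩ := hij x hx y' h1
    exact long x hx.1 y' hyS' h1 hx.2.1.le h4 (.inl fun e => by
      have := hx.2.1; rw [e] at this; exact this.false) ⟨y, hy, h2, h3⟩
  have left : ∀ y y', G.Adj x y' → f y < f x → f y' < f y → y ∈ S →
      ∃ a b c d, G.IsCubicPair a b c d := by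
    intro y y' h1 h2 h3 hy
    obtain ⟨hyS', h4, -⟩ := hij x hx y' h1
    exact long y' hyS' x hx.1 h1.symm h4 hx.2.2.le (.inr fun e => by
      have := hx.2.2; rw [e] at this; exact this.false) ⟨y, hy, h3, h2⟩
  have two : ∀ y y', G.Adj x y → G.Adj x y' → y ≠ y' →
      (f x < f y ∧ f x < f y' ∨ f y < f x ∧ f y' < f x) → ∃ a b c d, G.IsCubicPair a b c d := by
    intro y y' h1 h2 hne hor
    have hy := (hij x hx y h1).1
    have hy' := (hij x hx y' h2).1
    rcases lt_or_gt_of_ne (fun e => hne (hf hy hy' e)) with h3 | h3 <;>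
      rcases hor with ⟨h4, h5⟩ | ⟨h4, h5⟩
    · exact right y y' h2 h4 h3 hy
    · exact left y' y h1 h5 h3 hy'
    · exact right y' y h1 h5 h3 hy'
    · exact left y y' h2 h4 h3 hy
  obtain ⟨y₁, y₂, y₃, a1, a2, a3, h12, h13, h23⟩ := hdeg' x hx
  have side : ∀ y, G.Adj x y → f x < f y ∨ f y < f x := fun y hy =>
    lt_or_gt_of_ne fun e => hy.ne (hf hx.1 (hij x hx y hy).1 e)
  rcases side y₁ a1 with s1 | s1 <;> rcases side y₂ a2 with s2 | s2 <;>
    rcases side y₃ a3 with s3 | s3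
  · exact two _ _ a1 a2 h12 (.inl ⟨s1, s2⟩)
  · exact two _ _ a1 a2 h12 (.inl ⟨s1, s2⟩)
  · exact two _ _ a1 a3 h13 (.inl ⟨s1, s3⟩)
  · exact two _ _ a2 a3 h23 (.inr ⟨s2, s3⟩)
  · exact two _ _ a2 a3 h23 (.inl ⟨s2, s3⟩)
  · exact two _ _ a1 a3 h13 (.inr ⟨s1, s3⟩)
  · exact two _ _ a1 a2 h12 (.inr ⟨s1, s2⟩)
  · exact two _ _ a1 a2 h12 (.inr ⟨s1, s2⟩)

theorem IsPseudoOuterplanar.exists_isCubicPair [Finite V] {G₀ : SimpleGraph V}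
    (hG : G₀.IsPseudoOuterplanar) (hle : G ≤ G₀) {u v : V} (huv : G.Adj u v)
    (hdeg : ∀ x y, G.Adj x y → 3 ≤ (G.neighborSet x).ncard) :
    ∃ a b c d, G.IsCubicPair a b c d := by
  obtain ⟨z, C, hC, hmin⟩ := exists_minimal_isHanging huv
  have hdeg3 : ∀ x ∈ C, ∃ y₁ y₂ y₃, G.Adj x y₁ ∧ G.Adj x y₂ ∧ G.Adj x y₃ ∧
      y₁ ≠ y₂ ∧ y₁ ≠ y₃ ∧ y₂ ≠ y₃ := by
    intro x hx
    obtain ⟨y, hxy⟩ := hC.exists_adj x hx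
    obtain ⟨y₁, h1, y₂, h2, y₃, h3, h⟩ := (Set.two_lt_ncard).1 (hdeg x y hxy)
    exact ⟨y₁, y₂, y₃, h1, h2, h3, h⟩
  have hns := hC.isNonseparable hle hmin fun x hx => by
    obtain ⟨y₁, y₂, y₃, a1, a2, -, h12, -, -⟩ := hdeg3 x hx
    by_cases h : y₁ = z
    · exact ⟨y₂, a2, fun h' => h12 (h.trans h'.symm)⟩
    · exact ⟨y₁, a1, h⟩
  obtain ⟨f, hf, hfz, hfc⟩ := hG.exists_order hle (Set.mem_insert z C) hns
  -- The starting interval runs from `z`, the first point, to the last point `j`. Its interior lies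
  -- in `C`, whose vertices have all their neighbors in `insert z C`, so it is closed.
  obtain ⟨j, hj, hjmax⟩ := (insert z C).toFinite.exists_maximalFor f _ ⟨z, Set.mem_insert z C⟩
  have hjm : ∀ x ∈ insert z C, f x ≤ f j := fun x hx => by
    by_contra! hlt
    exact absurd (hjmax hx hlt.le) (not_le.2 hlt)
  have hbC : ∀ x ∈ betweenPoints (insert z C) f z j, x ∈ C := fun x hx =>
    hx.1.resolve_left fun e => by have := hx.2.1; rw [e] at this; exact this.false
  have hN : ∀ x ∈ C, ∀ y, G.Adj x y → y ∈ insert z C := fun x hx y hxy => hC.closed x hx y hxy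
  refine hfc.exists_isCubicPair hf (Set.mem_insert z C) hj (fun x hx y hxy => ?_) ?_
    (fun x hx => hdeg3 x (hbC x hx))
  · have hy := hN x (hbC x hx) y hxy
    exact ⟨hy, hfz y hy, hjm y hy⟩
  · obtain ⟨w, hw⟩ := hC.nonempty
    have hzw : f z < f w := lt_of_le_of_ne (hfz w (Set.mem_insert_of_mem _ hw)) fun e =>
      hC.notMem (hf (Set.mem_insert z C) (Set.mem_insert_of_mem _ hw) e ▸ hw)
    have hjC : j ∈ C := hj.resolve_left fun e => by
      have := hjm w (Set.mem_insert_of_mem _ hw)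
      rw [e] at this; linarith
    obtain ⟨y₁, y₂, y₃, a1, a2, -, h12, -, -⟩ := hdeg3 j hjC
    have : ∀ y, G.Adj j y → y ≠ z → (betweenPoints (insert z C) f z j).Nonempty := by
      intro y hy hyz
      have hyS := hN j hjC y hy
      exact ⟨y, hyS, lt_of_le_of_ne (hfz y hyS) fun e => hyz (hf (Set.mem_insert z C) hyS e).symm,
        lt_of_le_of_ne (hjm y hyS) fun e => hy.ne' (hf hyS hj e)⟩
    by_cases h : y₁ = z
    · exact this y₂ a2 fun h' => h12 (h.trans h'.symm)
    · exact this y₁ a1 h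

end Interval

/-! ### Extending partial total colorings. -/

section Coloring

variable {V : Type*} {G : SimpleGraph V} {α : Type*}

/-- A total coloring of `G`, given by colors `cv` of vertices and `ce` of pairs of vertices, in
which only the vertices in `U` are regarded as colored. -/
structure IsPartialTotalColoring (G : SimpleGraph V) (U : Set V) (cv : V → α)
    (ce : Sym2 V → α) : Prop where
  vertex_ne : ∀ x ∈ U, ∀ y ∈ U, G.Adj x y → cv x ≠ cv y
  edge_ne : ∀ x y z, G.Adj x y → G.Adj x z → y ≠ z → ce s(x, y) ≠ ce s(x, z)
  incident_ne : ∀ x ∈ U, ∀ y, G.Adj x y → cv x ≠ ce s(x, y)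

namespace IsPartialTotalColoring

variable {U U' : Set V} {cv : V → α} {ce : Sym2 V → α}

theorem totalColorable {k : ℕ} {cv : V → Fin k} {ce : Sym2 V → Fin k}
    (h : G.IsPartialTotalColoring Set.univ cv ce) : G.TotalColorable k := by
  refine ⟨Sum.elim cv fun e => ce e.1, fun x y hxy => h.vertex_ne x trivial y trivial hxy, ?_, ?_⟩
  · rintro ⟨e, he⟩ ⟨f, hf⟩ hef ⟨x, hxe, hxf⟩
    obtain ⟨y, rfl⟩ := Sym2.mem_iff_exists.1 hxe
    obtain ⟨z, rfl⟩ := Sym2.mem_iff_exists.1 hxf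
    exact h.edge_ne x y z he hf fun hyz => hef (by simp [hyz])
  · rintro x ⟨e, he⟩ hxe
    obtain ⟨y, rfl⟩ := Sym2.mem_iff_exists.1 hxe
    exact h.incident_ne x trivial y he

theorem mono {G' : SimpleGraph V} (h : G.IsPartialTotalColoring U cv ce) (hG : G' ≤ G)
    (hU : U' ⊆ U) : G'.IsPartialTotalColoring U' cv ce :=
  ⟨fun x hx y hy hxy => h.vertex_ne x (hU hx) y (hU hy) (hG hxy),
    fun x y z hxy hxz => h.edge_ne x y z (hG hxy) (hG hxz),
    fun x hx y hxy => h.incident_ne x (hU hx) y (hG hxy)⟩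

theorem update_edge [DecidableEq V] {u v : V}
    (h : (G.deleteEdges {s(u, v)}).IsPartialTotalColoring U cv ce) {c : α}
    (h1 : ∀ w, G.Adj u w → w ≠ v → c ≠ ce s(u, w)) (h2 : ∀ w, G.Adj v w → w ≠ u → c ≠ ce s(v, w))
    (hu : u ∉ U) (hv : v ∈ U → c ≠ cv v) :
    G.IsPartialTotalColoring U cv (Function.update ce s(u, v) c) := by
  have hd : ∀ x y, G.Adj x y → s(x, y) ≠ s(u, v) → (G.deleteEdges {s(u, v)}).Adj x y :=
    fun x y hxy hne => deleteEdges_adj.2 ⟨hxy, hne⟩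
  have hc : ∀ x y z, G.Adj x z → y ≠ z → s(x, y) = s(u, v) → c ≠ ce s(x, z) := by
    intro x y z hxz hyz he
    rcases Sym2.eq_iff.1 he with ⟨rfl, rfl⟩ | ⟨rfl, rfl⟩
    · exact h1 z hxz hyz.symm
    · exact h2 z hxz hyz.symm
  refine ⟨fun x hx y hy hxy => ?_, fun x y z hxy hxz hyz => ?_, fun x hx y hxy => ?_⟩
  · by_cases he : s(x, y) = s(u, v)
    · rcases Sym2.eq_iff.1 he with ⟨rfl, rfl⟩ | ⟨rfl, rfl⟩
      · exact absurd hx hu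
      · exact absurd hy hu
    · exact h.vertex_ne x hx y hy (hd x y hxy he)
  · by_cases he : s(x, y) = s(u, v)
    · have he' : s(x, z) ≠ s(u, v) := fun he' => hyz (Sym2.congr_right.1 (he.trans he'.symm))
      rw [he, Function.update_self, Function.update_of_ne he']
      exact hc x y z hxz hyz he
    · rw [Function.update_of_ne he]
      by_cases he' : s(x, z) = s(u, v)
      · rw [he', Function.update_self]
        exact (hc x z y hxy hyz.symm he').symm
      · rw [Function.update_of_ne he']
        exact h.edge_ne x y z (hd x y hxy he) (hd x z hxz he') hyz
  · by_cases he : s(x, y) = s(u, v)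
    · rw [he, Function.update_self]
      rcases Sym2.eq_iff.1 he with ⟨rfl, rfl⟩ | ⟨rfl, rfl⟩
      · exact absurd hx hu
      · exact (hv hx).symm
    · rw [Function.update_of_ne he]
      exact h.incident_ne x hx y (hd x y hxy he)

theorem update_vertex [DecidableEq V] {u : V} (h : G.IsPartialTotalColoring (U \ {u}) cv ce)
    {c : α} (h1 : ∀ w ∈ U, G.Adj u w → c ≠ cv w) (h2 : ∀ w, G.Adj u w → c ≠ ce s(u, w)) :
    G.IsPartialTotalColoring U (Function.update cv u c) ce := by
  refine ⟨fun x hx y hy hxy => ?_, h.edge_ne, fun x hx y hxy => ?_⟩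
  · by_cases hxu : x = u
    · subst hxu
      rw [Function.update_self, Function.update_of_ne hxy.ne']
      exact h1 y hy hxy
    · rw [Function.update_of_ne hxu]
      by_cases hyu : y = u
      · subst hyu
        rw [Function.update_self]
        exact (h1 x hx hxy.symm).symm
      · rw [Function.update_of_ne hyu]
        exact h.vertex_ne x ⟨hx, hxu⟩ y ⟨hy, hyu⟩ hxy
  · by_cases hxu : x = u
    · subst hxu
      rw [Function.update_self]
      exact h2 y hxy
    · rw [Function.update_of_ne hxu]
      exact h.incident_ne x ⟨hx, hxu⟩ y hxy

/-- Coloring an edge together with its two ends. -/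
theorem exists_of_edge_and_ends {b c : V} (hbc : G.Adj b c)
    (h : (G.deleteEdges {s(b, c)}).IsPartialTotalColoring ((Set.univ \ {b}) \ {c}) cv ce)
    {xb xc xe : α} (hb : ∀ w, G.Adj b w → w ≠ c → xb ≠ cv w ∧ xb ≠ ce s(b, w))
    (hc : ∀ w, G.Adj c w → w ≠ b → xc ≠ cv w ∧ xc ≠ ce s(c, w))
    (heb : ∀ w, G.Adj b w → w ≠ c → xe ≠ ce s(b, w))
    (hec : ∀ w, G.Adj c w → w ≠ b → xe ≠ ce s(c, w))
    (h1 : xb ≠ xc) (h2 : xb ≠ xe) (h3 : xc ≠ xe) :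
    ∃ (cv : V → α) (ce : Sym2 V → α), G.IsPartialTotalColoring Set.univ cv ce := by
  classical
  have e1 := h.update_edge (c := xe) heb hec (by simp) (by simp)
  have hne : ∀ x w, w ≠ c → (x = b ∨ x = c) → w ≠ b → s(x, w) ≠ s(b, c) := by
    intro x w hw hx hwb he
    rcases Sym2.eq_iff.1 he with ⟨rfl, rfl⟩ | ⟨rfl, rfl⟩
    · exact hw rfl
    · exact hwb rfl
  have e2 := e1.update_vertex (c := xc) (u := c) ?_ ?_
  · refine ⟨_, _, e2.update_vertex (c := xb) (u := b) ?_ ?_⟩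
    · intro w _ hw
      by_cases hwc : w = c
      · rw [hwc, Function.update_self]; exact h1
      · rw [Function.update_of_ne hwc]; exact (hb w hw hwc).1
    · intro w hw
      by_cases hwc : w = c
      · rw [hwc, Function.update_self]; exact h2
      · rw [Function.update_of_ne (hne b w hwc (.inl rfl) hw.ne')]; exact (hb w hw hwc).2
  · intro w hw' hw
    exact (hc w hw hw'.2).1
  · intro w hw
    by_cases hwb : w = b
    · rw [hwb, Sym2.eq_swap, Function.update_self]; exact h3
    · rw [Function.update_of_ne (hne c w hw.ne' (.inr rfl) hwb)]; exact (hc w hw hwb).2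

end IsPartialTotalColoring

theorem exists_notMem_of_ncard_lt {k : ℕ} {S : Set (Fin k)} (h : S.ncard < k) : ∃ x, x ∉ S := by
  by_contra! hS
  rw [Set.eq_univ_of_forall hS, Set.ncard_univ, Nat.card_fin] at h
  exact h.false

/-- An edge `uv` with an end `u` of low degree can be deleted and colored later. -/
theorem exists_coloring_of_low_degree [Finite V] {k : ℕ} {u v : V} (huv : G.Adj u v)
    (h1 : (G.neighborSet u).ncard + (G.neighborSet v).ncard ≤ k)
    (h2 : 2 * (G.neighborSet u).ncard < k)
    (h : ∃ (cv : V → Fin k) (ce : Sym2 V → Fin k),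
      (G.deleteEdges {s(u, v)}).IsPartialTotalColoring Set.univ cv ce) :
    ∃ (cv : V → Fin k) (ce : Sym2 V → Fin k), G.IsPartialTotalColoring Set.univ cv ce := by
  classical
  obtain ⟨cv, ce, h⟩ := h
  have cu : (G.neighborSet u \ {v}).ncard + 1 = (G.neighborSet u).ncard :=
    Set.ncard_sdiff_singleton_add_one huv
  have cv' : (G.neighborSet v \ {u}).ncard + 1 = (G.neighborSet v).ncard :=
    Set.ncard_sdiff_singleton_add_one huv.symm
  -- With `u` uncolored, the edge `uv` sees `d(u) - 1` edges, `d(v) - 1` edges and the vertex `v`.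
  -- Afterwards `u` sees at most `2 d(u)` colors.
  obtain ⟨x, hx⟩ := exists_notMem_of_ncard_lt (k := k)
    (S := ((fun w => ce s(u, w)) '' (G.neighborSet u \ {v}) ∪
      (fun w => ce s(v, w)) '' (G.neighborSet v \ {u})) ∪ {cv v}) (by
    have a1 := Set.ncard_image_le (f := fun w => ce s(u, w))
      (Set.toFinite (G.neighborSet u \ {v}))
    have a2 := Set.ncard_image_le (f := fun w => ce s(v, w))
      (Set.toFinite (G.neighborSet v \ {u}))
    refine lt_of_le_of_lt ((Set.ncard_union_le _ _).trans
      (add_le_add_left (Set.ncard_union_le _ _) _)) ?_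
    rw [Set.ncard_singleton]
    omega)
  simp only [Set.mem_union, not_or] at hx
  have e := (h.mono le_rfl (Set.subset_univ (Set.univ \ {u}))).update_edge (c := x)
    (fun w hw hwv he => hx.1.1 ⟨w, ⟨hw, hwv⟩, he.symm⟩)
    (fun w hw hwu he => hx.1.2 ⟨w, ⟨hw, hwu⟩, he.symm⟩) (by simp) (fun _ he => hx.2 he)
  obtain ⟨y, hy⟩ := exists_notMem_of_ncard_lt (k := k)
    (S := cv '' G.neighborSet u ∪
      (fun w => Function.update ce s(u, v) x s(u, w)) '' G.neighborSet u) (by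
    have a1 := Set.ncard_image_le (f := cv) (Set.toFinite (G.neighborSet u))
    have a2 := Set.ncard_image_le (f := fun w => Function.update ce s(u, v) x s(u, w))
      (Set.toFinite (G.neighborSet u))
    refine lt_of_le_of_lt (Set.ncard_union_le _ _) ?_
    omega)
  simp only [Set.mem_union, not_or] at hy
  exact ⟨_, _, e.update_vertex (c := y) (fun w _ hw he => hy.1 ⟨w, hw, he.symm⟩)
    (fun w hw he => hy.2 ⟨w, hw, he.symm⟩)⟩

theorem exists_distinct_of_notMem [DecidableEq α] {L₁ L₂ L₃ : Finset α} (h2 : 2 ≤ L₂.card)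
    (h3 : 2 ≤ L₃.card) {x : α} (hx : x ∈ L₁) (hx2 : x ∉ L₂) :
    ∃ a ∈ L₁, ∃ b ∈ L₂, ∃ c ∈ L₃, a ≠ b ∧ a ≠ c ∧ b ≠ c := by
  obtain ⟨c, hc, hcx⟩ := Finset.exists_mem_ne h3 x
  obtain ⟨b, hb, hbc⟩ := Finset.exists_mem_ne h2 c
  exact ⟨x, hx, b, hb, c, hc, fun h => hx2 (h ▸ hb), hcx.symm, hbc⟩

/-- Hall's condition for three lists of size at least 2 fails only when all three are one and the
same pair. If two lists differ, a color in one but not the other is used first. -/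
theorem exists_distinct [DecidableEq α] {L₁ L₂ L₃ : Finset α} (h1 : 2 ≤ L₁.card)
    (h2 : 2 ≤ L₂.card) (h3 : 2 ≤ L₃.card) (h : L₁ = L₂ → L₁ = L₃ → 3 ≤ L₁.card) :
    ∃ a ∈ L₁, ∃ b ∈ L₂, ∃ c ∈ L₃, a ≠ b ∧ a ≠ c ∧ b ≠ c := by
  by_cases h12 : L₁ = L₂
  · by_cases h13 : L₁ = L₃
    · obtain ⟨a, b, c, ha, hb, hc, hab, hac, hbc⟩ := Finset.two_lt_card_iff.1 (h h12 h13)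
      exact ⟨a, ha, b, h12 ▸ hb, c, h13 ▸ hc, hab, hac, hbc⟩
    · by_cases hs : L₁ ⊆ L₃
      · obtain ⟨x, hx, hx'⟩ := Finset.not_subset.1 fun h' => h13 (hs.antisymm h')
        obtain ⟨c, hc, a, ha, b, hb, e1, e2, e3⟩ := exists_distinct_of_notMem h1 h2 hx hx'
        exact ⟨a, ha, b, hb, c, hc, e3, e1.symm, e2.symm⟩
      · obtain ⟨x, hx, hx'⟩ := Finset.not_subset.1 hs
        obtain ⟨a, ha, c, hc, b, hb, e1, e2, e3⟩ := exists_distinct_of_notMem h3 h2 hx hx'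
        exact ⟨a, ha, b, hb, c, hc, e2, e1, e3.symm⟩
  · by_cases hs : L₁ ⊆ L₂
    · obtain ⟨x, hx, hx'⟩ := Finset.not_subset.1 fun h' => h12 (hs.antisymm h')
      obtain ⟨b, hb, a, ha, c, hc, e1, e2, e3⟩ := exists_distinct_of_notMem h1 h3 hx hx'
      exact ⟨a, ha, b, hb, c, hc, e1.symm, e3, e2⟩
    · obtain ⟨x, hx, hx'⟩ := Finset.not_subset.1 hs
      exact exists_distinct_of_notMem h2 h3 hx hx'

/-- Coloring an edge together with its two ends, from the sets of forbidden colors. -/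
theorem IsPartialTotalColoring.exists_of_forbidden {k : ℕ} {cv : V → Fin k} {ce : Sym2 V → Fin k}
    {b c : V} (hbc : G.Adj b c)
    (h : (G.deleteEdges {s(b, c)}).IsPartialTotalColoring ((Set.univ \ {b}) \ {c}) cv ce)
    {Fb Fc Fe : Finset (Fin k)} (hb : ∀ w, G.Adj b w → w ≠ c → cv w ∈ Fb ∧ ce s(b, w) ∈ Fb)
    (hc : ∀ w, G.Adj c w → w ≠ b → cv w ∈ Fc ∧ ce s(c, w) ∈ Fc)
    (heb : ∀ w, G.Adj b w → w ≠ c → ce s(b, w) ∈ Fe)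
    (hec : ∀ w, G.Adj c w → w ≠ b → ce s(c, w) ∈ Fe)
    (h1 : Fb.card + 2 ≤ k) (h2 : Fc.card + 2 ≤ k) (h3 : Fe.card + 2 ≤ k)
    (hF : Fb = Fc → Fb = Fe → Fb.card + 3 ≤ k) :
    ∃ (cv : V → Fin k) (ce : Sym2 V → Fin k), G.IsPartialTotalColoring Set.univ cv ce := by
  have hcard : ∀ F : Finset (Fin k), (Fᶜ).card = k - F.card := fun F => by
    rw [Finset.card_compl, Fintype.card_fin]
  obtain ⟨xb, hxb, xc, hxc, xe, hxe, e1, e2, e3⟩ := exists_distinct (L₁ := Fbᶜ) (L₂ := Fcᶜ)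
    (L₃ := Feᶜ) (by rw [hcard]; omega) (by rw [hcard]; omega) (by rw [hcard]; omega)
    (fun h h' => by
      have := hF (compl_injective h) (compl_injective h')
      rw [hcard]; omega)
  rw [Finset.mem_compl] at hxb hxc hxe
  have ne : ∀ {F : Finset (Fin k)} {x y : Fin k}, x ∉ F → y ∈ F → x ≠ y :=
    fun hx hy h => hx (h ▸ hy)
  exact h.exists_of_edge_and_ends hbc (fun w hw hwc => ⟨ne hxb (hb w hw hwc).1,
    ne hxb (hb w hw hwc).2⟩) (fun w hw hwc => ⟨ne hxc (hc w hw hwc).1, ne hxc (hc w hw hwc).2⟩)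
    (fun w hw hwc => ne hxe (heb w hw hwc)) (fun w hw hwc => ne hxe (hec w hw hwc)) e1 e2 e3

/-- The choice for `u`, `v`, `uv` can fail only if `u` and `v` have the same forbidden colors.
Recoloring `ua` destroys this coincidence. -/
theorem exists_coloring_of_degree_two [Finite V] {u v a b : V} (huv : G.Adj u v) (ha : a ≠ v)
    (hNu : ∀ w, G.Adj u w ↔ w = a ∨ w = v) (hNv : ∀ w, G.Adj v w ↔ w = b ∨ w = u)
    (hda : (G.neighborSet a).ncard ≤ 2)
    (h : ∃ (cv : V → Fin 4) (ce : Sym2 V → Fin 4),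
      (G.deleteEdges {s(u, v)}).IsPartialTotalColoring Set.univ cv ce) :
    ∃ (cv : V → Fin 4) (ce : Sym2 V → Fin 4), G.IsPartialTotalColoring Set.univ cv ce := by
  classical
  obtain ⟨cv, ce, h⟩ := h
  have hua : G.Adj u a := (hNu a).2 (.inl rfl)
  have key : ∀ ce' : Sym2 V → Fin 4, (G.deleteEdges {s(u, v)}).IsPartialTotalColoring
      ((Set.univ \ {u}) \ {v}) cv ce' →
      ({cv a, ce' s(u, a)} : Finset (Fin 4)) ≠ {cv b, ce' s(v, b)} →
      ∃ (cv : V → Fin 4) (ce : Sym2 V → Fin 4), G.IsPartialTotalColoring Set.univ cv ce := by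
    intro ce' h' hF
    refine h'.exists_of_forbidden (Fb := {cv a, ce' s(u, a)}) (Fc := {cv b, ce' s(v, b)})
      (Fe := {ce' s(u, a), ce' s(v, b)}) huv ?_ ?_ ?_ ?_
      (by have := Finset.card_le_two (a := cv a) (b := ce' s(u, a)); omega)
      (by have := Finset.card_le_two (a := cv b) (b := ce' s(v, b)); omega)
      (by have := Finset.card_le_two (a := ce' s(u, a)) (b := ce' s(v, b)); omega)
      (fun h1 _ => (hF h1).elim)
    · intro w hw hwv
      obtain rfl := ((hNu w).1 hw).resolve_right hwv
      simp
    · intro w hw hwv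
      obtain rfl := ((hNv w).1 hw).resolve_right hwv
      simp
    · intro w hw hwv
      obtain rfl := ((hNu w).1 hw).resolve_right hwv
      simp
    · intro w hw hwv
      obtain rfl := ((hNv w).1 hw).resolve_right hwv
      simp
  have h' := h.mono le_rfl (Set.subset_univ ((Set.univ \ {u}) \ {v}))
  by_contra hcon
  have h1 := not_not.1 fun hF => hcon (key ce h' hF)
  -- At most three colors are excluded: that of `a`, the old color of `ua`, and that of the other
  -- edge at `a`. So `z` is outside the former common forbidden set.
  obtain ⟨z, hz⟩ := exists_notMem_of_ncard_lt (k := 4)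
    (S := ((fun w => ce s(a, w)) '' (G.neighborSet a \ {u})) ∪ {cv a, ce s(u, a)}) (by
    have a1 := Set.ncard_image_le (f := fun w => ce s(a, w))
      (Set.toFinite (G.neighborSet a \ {u}))
    have a2 : (G.neighborSet a \ {u}).ncard + 1 = (G.neighborSet a).ncard :=
      Set.ncard_sdiff_singleton_add_one hua.symm
    refine lt_of_le_of_lt (Set.ncard_union_le _ _) ?_
    have := Set.ncard_insert_le (cv a) {ce s(u, a)}
    rw [Set.ncard_singleton] at this
    omega)
  simp only [Set.mem_union, not_or, Set.mem_insert_iff, Set.mem_singleton_iff] at hz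
  have e := (h'.mono (deleteEdges_le {s(u, a)}) le_rfl).update_edge (u := u) (v := a) (c := z)
    (fun w hw hwa => by
      rw [deleteEdges_adj] at hw
      rcases (hNu w).1 hw.1 with rfl | rfl
      · exact absurd rfl hwa
      · exact absurd rfl hw.2)
    (fun w hw hwu he => hz.1 ⟨w, ⟨(deleteEdges_adj.1 hw).1, hwu⟩, he.symm⟩)
    (by simp) (fun _ => hz.2.1)
  have hne : s(v, b) ≠ s(u, a) := by
    intro he
    rcases Sym2.eq_iff.1 he with ⟨h3, -⟩ | ⟨h3, -⟩
    · exact huv.ne' h3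
    · exact ha h3.symm
  refine hcon (key _ e ?_)
  rw [Function.update_self, Function.update_of_ne hne]
  intro h3
  have : z ∈ ({cv b, ce s(v, b)} : Finset (Fin 4)) := h3 ▸ by simp
  rw [← h1] at this
  simp [hz.2.1, hz.2.2] at this

/-- Each of `b`, `c`, `bc` has at most four forbidden colors, hence two free ones. If the three
forbidden sets coincide, the color of `a` repeats among the edge colors, so only three colors are
forbidden. -/
theorem IsCubicPair.exists_coloring_six {a b c d : V} (hp : G.IsCubicPair a b c d)
    (h : ∃ (cv : V → Fin 6) (ce : Sym2 V → Fin 6),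
      (G.deleteEdges {s(b, c)}).IsPartialTotalColoring Set.univ cv ce) :
    ∃ (cv : V → Fin 6) (ce : Sym2 V → Fin 6), G.IsPartialTotalColoring Set.univ cv ce := by
  classical
  obtain ⟨cv, ce, h⟩ := h
  have had := hp.ne
  have hba : G.Adj b a := (hp.adj_left a).2 (.inl rfl)
  have hbc : G.Adj b c := (hp.adj_left c).2 (.inr (.inl rfl))
  have hbd : G.Adj b d := (hp.adj_left d).2 (.inr (.inr rfl))
  have hca : G.Adj c a := (hp.adj_right a).2 (.inl rfl)
  have hcd : G.Adj c d := (hp.adj_right d).2 (.inr (.inr rfl))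
  have del : ∀ x y, G.Adj x y → (x ≠ b ∧ x ≠ c ∨ y ≠ b ∧ y ≠ c) →
      (G.deleteEdges {s(b, c)}).Adj x y := by
    intro x y hxy hor
    refine deleteEdges_adj.2 ⟨hxy, fun he => ?_⟩
    rcases Sym2.eq_iff.1 he with ⟨rfl, rfl⟩ | ⟨rfl, rfl⟩ <;> tauto
  have dba := del b a hba (.inr ⟨hba.ne', hca.ne'⟩)
  have dbd := del b d hbd (.inr ⟨hbd.ne', hcd.ne'⟩)
  have dca := del c a hca (.inr ⟨hba.ne', hca.ne'⟩)
  have dcd := del c d hcd (.inr ⟨hbd.ne', hcd.ne'⟩)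
  have n1 := h.edge_ne b a d dba dbd had
  have n2 := h.edge_ne c a d dca dcd had
  have n3 := h.edge_ne a b c dba.symm dca.symm hbc.ne
  have n4 := h.edge_ne d b c dbd.symm dcd.symm hbc.ne
  have n5 := h.incident_ne a trivial b dba.symm
  have n6 := h.incident_ne a trivial c dca.symm
  have n7 := h.incident_ne d trivial b dbd.symm
  have n8 := h.incident_ne d trivial c dcd.symm
  rw [Sym2.eq_swap (a := a), Sym2.eq_swap (a := a)] at n3
  rw [Sym2.eq_swap (a := d), Sym2.eq_swap (a := d)] at n4
  rw [Sym2.eq_swap] at n5 n6 n7 n8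
  have c4 : ∀ x y z w : Fin 6, ({x, y, z, w} : Finset (Fin 6)).card ≤ 4 :=
    fun _ _ _ _ => Finset.card_le_four
  refine (h.mono le_rfl (Set.subset_univ _)).exists_of_forbidden hbc
    (Fb := {cv a, cv d, ce s(b, a), ce s(b, d)}) (Fc := {cv a, cv d, ce s(c, a), ce s(c, d)})
    (Fe := {ce s(b, a), ce s(b, d), ce s(c, a), ce s(c, d)}) ?_ ?_ ?_ ?_
    (Nat.add_le_add_right (c4 _ _ _ _) 2) (Nat.add_le_add_right (c4 _ _ _ _) 2)
    (Nat.add_le_add_right (c4 _ _ _ _) 2) ?_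
  · intro w hw hwc
    have := (hp.adj_left w).1 hw
    rcases this with rfl | rfl | rfl <;> simp at hwc ⊢
  · intro w hw hwc
    have := (hp.adj_right w).1 hw
    rcases this with rfl | rfl | rfl <;> simp at hwc ⊢
  · intro w hw hwc
    have := (hp.adj_left w).1 hw
    rcases this with rfl | rfl | rfl <;> simp at hwc ⊢
  · intro w hw hwc
    have := (hp.adj_right w).1 hw
    rcases this with rfl | rfl | rfl <;> simp at hwc ⊢
  · generalize cv a = A at *
    generalize cv d = D at *
    generalize ce s(b, a) = ba at *
    generalize ce s(b, d) = bd at *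
    generalize ce s(c, a) = ca at *
    generalize ce s(c, d) = cd at *
    intro e1 e2
    suffices h3 : ({A, D, ba, bd} : Finset (Fin 6)).card ≤ 3 from Nat.add_le_add_right h3 3
    have m1 : A ∈ ({ba, bd, ca, cd} : Finset (Fin 6)) := e2 ▸ by simp
    have m2 : D ∈ ({ba, bd, ca, cd} : Finset (Fin 6)) := e2 ▸ by simp
    simp only [Finset.mem_insert, Finset.mem_singleton] at m1 m2
    have c3 : ∀ x y z : Fin 6, ({x, y, z} : Finset (Fin 6)).card ≤ 3 :=
      fun _ _ _ => Finset.card_le_three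
    -- The color of `a` differs from those of `ba` and `ca`, which are incident with `a`.
    have hA : A = bd ∨ A = cd := by tauto
    rcases hA with rfl | rfl
    · rw [show ({A, D, ba, A} : Finset (Fin 6)) = {A, D, ba} by ext; simp; tauto]
      exact c3 _ _ _
    · rw [e1, show ({A, D, ca, A} : Finset (Fin 6)) = {A, D, ca} by ext; simp; tauto]
      exact c3 _ _ _

end Coloring

/-! ### Cubic pairs with five colors. -/

section Cubic

variable {V : Type*} {G : SimpleGraph V}

theorem exists_forall_eq_of_ncard_le_one {S : Set V} [Finite V] (h : S.ncard ≤ 1) (x₀ : V) :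
    ∃ x, ∀ y ∈ S, y = x := by
  rcases S.eq_empty_or_nonempty with rfl | ⟨x, hx⟩
  · exact ⟨x₀, fun y hy => hy.elim⟩
  · exact ⟨x, fun y hy => (Set.ncard_le_one).1 h y hy x hx⟩

theorem exists_notMem_list {k : ℕ} (l : List (Fin k)) (h : l.length < k) : ∃ x, x ∉ l := by
  classical
  by_contra! hl
  have h1 : l.toFinset = Finset.univ := Finset.eq_univ_of_forall fun x => List.mem_toFinset.2 (hl x)
  have h2 := List.toFinset_card_le l
  rw [h1, Finset.card_univ, Fintype.card_fin] at h2
  omega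

/-- The vertex `y` need not be adjacent to `x`; it is a dummy when `x` has degree 2. -/
theorem exists_third_neighbor [Finite V] {b c x : V} (hbc : b ≠ c) (hb : G.Adj x b)
    (hc : G.Adj x c) (hx : (G.neighborSet x).ncard ≤ 3) :
    ∃ y, ∀ w, G.Adj x w → w = b ∨ w = c ∨ w = y := by
  have h1 : (G.neighborSet x \ {b}).ncard + 1 = (G.neighborSet x).ncard :=
    Set.ncard_sdiff_singleton_add_one hb
  have h2 : ((G.neighborSet x \ {b}) \ {c}).ncard + 1 = (G.neighborSet x \ {b}).ncard :=
    Set.ncard_sdiff_singleton_add_one ⟨hc, hbc.symm⟩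
  obtain ⟨y, hy⟩ := exists_forall_eq_of_ncard_le_one
    (S := (G.neighborSet x \ {b}) \ {c}) (by omega) x
  refine ⟨y, fun w hw => ?_⟩
  by_cases h3 : w = b
  · exact .inl h3
  by_cases h4 : w = c
  · exact .inr (.inl h4)
  exact .inr (.inr (hy w ⟨⟨hw, h3⟩, h4⟩))

/-- Here `a`, `b`, `c`, `d` form a component `K₄`, which is colored from scratch. -/
theorem IsCubicPair.exists_coloring_five_of_adj {a b c d : V}
    (hp : G.IsCubicPair a b c d) (hNa : ∀ w, G.Adj a w → w = b ∨ w = c ∨ w = d)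
    (hNd : ∀ w, G.Adj d w → w = b ∨ w = c ∨ w = a)
    (h : ∃ (cv : V → Fin 5) (ce : Sym2 V → Fin 5),
      (G.deleteEdges {s(b, c)}).IsPartialTotalColoring Set.univ cv ce) :
    ∃ (cv : V → Fin 5) (ce : Sym2 V → Fin 5), G.IsPartialTotalColoring Set.univ cv ce := by
  classical
  obtain ⟨cv, ce, h⟩ := h
  have had := hp.ne
  have hab : a ≠ b := ((hp.adj_left a).2 (.inl rfl)).ne'
  have hbc : b ≠ c := ((hp.adj_left c).2 (.inr (.inl rfl))).ne
  have hbd : b ≠ d := ((hp.adj_left d).2 (.inr (.inr rfl))).ne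
  have hac : a ≠ c := ((hp.adj_right a).2 (.inl rfl)).ne'
  have hcd : c ≠ d := ((hp.adj_right d).2 (.inr (.inr rfl))).ne
  have del : ∀ x y, G.Adj x y → x ≠ b → x ≠ c → (G.deleteEdges {s(b, c)}).Adj x y := by
    intro x y hxy h1 h2
    refine deleteEdges_adj.2 ⟨hxy, fun he => ?_⟩
    rcases Sym2.eq_iff.1 he with ⟨rfl, rfl⟩ | ⟨rfl, rfl⟩ <;> tauto
  obtain ⟨cv', hcv'⟩ : ∃ cv' : V → Fin 5, cv' = fun x =>
      if x = a then 0 else if x = b then 1 else if x = c then 2 else if x = d then 3 else cv x :=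
    ⟨_, rfl⟩
  -- The matching `ab`, `cd` gets the fifth color; along the cycle `a c b d`, each edge takes the
  -- color of the vertex that follows it.
  obtain ⟨ce', hce'⟩ : ∃ ce' : Sym2 V → Fin 5, ce' = fun e =>
      if e = s(a, b) ∨ e = s(c, d) then 4 else if e = s(a, c) then 1 else if e = s(b, c) then 3
      else if e = s(b, d) then 0 else if e = s(a, d) then 2 else ce e := ⟨_, rfl⟩
  have va : cv' a = 0 := by simp [hcv']
  have vb : cv' b = 1 := by simp [hcv', hab.symm]
  have vc : cv' c = 2 := by simp [hcv', hac.symm, hbc.symm]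
  have vd : cv' d = 3 := by simp [hcv', had.symm, hbd.symm, hcd.symm]
  have vx : ∀ x, x ≠ a → x ≠ b → x ≠ c → x ≠ d → cv' x = cv x := by
    intro x h1 h2 h3 h4; simp [hcv', h1, h2, h3, h4]
  have ab : ce' s(a, b) = 4 := by simp [hce']
  have cd : ce' s(c, d) = 4 := by simp [hce']
  have ac : ce' s(a, c) = 1 := by simp [hce', had, hac, hab, hbc.symm]
  have bc : ce' s(b, c) = 3 := by simp [hce', hab.symm, hac.symm, hbc, hbd]
  have bd : ce' s(b, d) = 0 := by simp [hce', hab.symm, had.symm, hbc, hbd, hcd.symm]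
  have ad : ce' s(a, d) = 2 := by simp [hce', hab, had, hac, hbd.symm, hcd.symm]
  have ba := (congrArg ce' (Sym2.eq_swap (a := b) (b := a))).trans ab
  have dc := (congrArg ce' (Sym2.eq_swap (a := d) (b := c))).trans cd
  have ca := (congrArg ce' (Sym2.eq_swap (a := c) (b := a))).trans ac
  have cb := (congrArg ce' (Sym2.eq_swap (a := c) (b := b))).trans bc
  have db := (congrArg ce' (Sym2.eq_swap (a := d) (b := b))).trans bd
  have da := (congrArg ce' (Sym2.eq_swap (a := d) (b := a))).trans ad
  have ex : ∀ x y, x ≠ a → x ≠ b → x ≠ c → x ≠ d → ce' s(x, y) = ce s(x, y) := by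
    intro x y h1 h2 h3 h4
    simp [hce', h1, h2, h3, h4]
  clear hcv' hce'
  have hN : ∀ x y, G.Adj x y → x ≠ a → x ≠ b → x ≠ c → x ≠ d →
      y ≠ a ∧ y ≠ b ∧ y ≠ c ∧ y ≠ d := by
    intro x y hxy h1 h2 h3 h4
    refine ⟨?_, ?_, ?_, ?_⟩ <;> rintro rfl
    · have := hNa x hxy.symm; tauto
    · have := (hp.adj_left x).1 hxy.symm; tauto
    · have := (hp.adj_right x).1 hxy.symm; tauto
    · have := hNd x hxy.symm; tauto
  have cases : ∀ x, x = a ∨ x = b ∨ x = c ∨ x = d ∨ (x ≠ a ∧ x ≠ b ∧ x ≠ c ∧ x ≠ d) := by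
    intro x; tauto
  refine ⟨cv', ce', fun x _ y _ hxy => ?_, fun x y z hxy hxz hyz => ?_, fun x _ y hxy => ?_⟩
  · rcases cases x with rfl | rfl | rfl | rfl | ⟨h1, h2, h3, h4⟩
    · rcases hNa y hxy with rfl | rfl | rfl <;> simp [*]
    · rcases (hp.adj_left y).1 hxy with rfl | rfl | rfl <;> simp [*]
    · rcases (hp.adj_right y).1 hxy with rfl | rfl | rfl <;> simp [*]
    · rcases hNd y hxy with rfl | rfl | rfl <;> simp [*]
    · obtain ⟨h5, h6, h7, h8⟩ := hN x y hxy h1 h2 h3 h4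
      rw [vx x h1 h2 h3 h4, vx y h5 h6 h7 h8]
      exact h.vertex_ne x trivial y trivial (del x y hxy h2 h3)
  · rcases cases x with rfl | rfl | rfl | rfl | ⟨h1, h2, h3, h4⟩
    · rcases hNa y hxy with rfl | rfl | rfl <;> rcases hNa z hxz with rfl | rfl | rfl <;>
        simp [*] at hyz ⊢
    · rcases (hp.adj_left y).1 hxy with rfl | rfl | rfl <;>
        rcases (hp.adj_left z).1 hxz with rfl | rfl | rfl <;> simp [*] at hyz ⊢
    · rcases (hp.adj_right y).1 hxy with rfl | rfl | rfl <;>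
        rcases (hp.adj_right z).1 hxz with rfl | rfl | rfl <;> simp [*] at hyz ⊢
    · rcases hNd y hxy with rfl | rfl | rfl <;> rcases hNd z hxz with rfl | rfl | rfl <;>
        simp [*] at hyz ⊢
    · rw [ex x y h1 h2 h3 h4, ex x z h1 h2 h3 h4]
      exact h.edge_ne x y z (del x y hxy h2 h3) (del x z hxz h2 h3) hyz
  · rcases cases x with rfl | rfl | rfl | rfl | ⟨h1, h2, h3, h4⟩
    · rcases hNa y hxy with rfl | rfl | rfl <;> simp [*]
    · rcases (hp.adj_left y).1 hxy with rfl | rfl | rfl <;> simp [*]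
    · rcases (hp.adj_right y).1 hxy with rfl | rfl | rfl <;> simp [*]
    · rcases hNd y hxy with rfl | rfl | rfl <;> simp [*]
    · rw [vx x h1 h2 h3 h4, ex x y h1 h2 h3 h4]
      exact h.incident_ne x trivial y (del x y hxy h2 h3)

/-- As `a` and `d` are not adjacent, one color `r` serves `a`, `d` and the edge `bc`. The 4-cycle `a
b d c` is colored alternately with `p` and `q`, which leaves `s` and `t` for `b` and `c`. -/
theorem IsCubicPair.exists_coloring_five_of_not_adj {a b c d a' d' : V}
    (hp : G.IsCubicPair a b c d) (hnad : ¬ G.Adj a d)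
    (hNa : ∀ w, G.Adj a w → w = b ∨ w = c ∨ w = a')
    (hNd : ∀ w, G.Adj d w → w = b ∨ w = c ∨ w = d')
    (h : ∃ (cv : V → Fin 5) (ce : Sym2 V → Fin 5),
      (G.deleteEdges {s(b, c)}).IsPartialTotalColoring Set.univ cv ce) :
    ∃ (cv : V → Fin 5) (ce : Sym2 V → Fin 5), G.IsPartialTotalColoring Set.univ cv ce := by
  classical
  obtain ⟨cv, ce, h⟩ := h
  have had := hp.ne
  have hab : a ≠ b := ((hp.adj_left a).2 (.inl rfl)).ne'
  have hbc : b ≠ c := ((hp.adj_left c).2 (.inr (.inl rfl))).ne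
  have hbd : b ≠ d := ((hp.adj_left d).2 (.inr (.inr rfl))).ne
  have hac : a ≠ c := ((hp.adj_right a).2 (.inl rfl)).ne'
  have hcd : c ≠ d := ((hp.adj_right d).2 (.inr (.inr rfl))).ne
  -- The outer edges `aa'` and `dd'` keep their colors, so `r`, `p`, `q` must avoid them; `s` and
  -- `t` need only differ from the other three and each other.
  obtain ⟨r, hr⟩ := exists_notMem_list [cv a', cv d', ce s(a, a'), ce s(d, d')] (by simp)
  obtain ⟨p, hp1⟩ := exists_notMem_list [r, ce s(a, a'), ce s(d, d')] (by simp)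
  obtain ⟨q, hq⟩ := exists_notMem_list [r, ce s(a, a'), ce s(d, d'), p] (by simp)
  obtain ⟨s, hs⟩ := exists_notMem_list [r, p, q] (by simp)
  obtain ⟨t, ht⟩ := exists_notMem_list [r, p, q, s] (by simp)
  simp only [List.mem_cons, List.not_mem_nil, or_false, not_or] at hr hp1 hq hs ht
  have del : ∀ x y, G.Adj x y → x ≠ b → x ≠ c → (G.deleteEdges {s(b, c)}).Adj x y := by
    intro x y hxy h1 h2
    refine deleteEdges_adj.2 ⟨hxy, fun he => ?_⟩
    rcases Sym2.eq_iff.1 he with ⟨rfl, rfl⟩ | ⟨rfl, rfl⟩ <;> tauto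
  obtain ⟨cv', hcv'⟩ : ∃ cv' : V → Fin 5, cv' = fun x =>
      if x = a ∨ x = d then r else if x = b then s else if x = c then t else cv x :=
    ⟨_, rfl⟩
  obtain ⟨ce', hce'⟩ : ∃ ce' : Sym2 V → Fin 5, ce' = fun e =>
      if e = s(a, b) ∨ e = s(c, d) then p else if e = s(a, c) ∨ e = s(b, d) then q
      else if e = s(b, c) then r else ce e := ⟨_, rfl⟩
  have va : cv' a = r := by simp [hcv']
  have vb : cv' b = s := by simp [hcv', hab.symm, hbd]
  have vc : cv' c = t := by simp [hcv', hac.symm, hbc.symm, hcd]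
  have vd : cv' d = r := by simp [hcv']
  have vx : ∀ x, x ≠ a → x ≠ b → x ≠ c → x ≠ d → cv' x = cv x := by
    intro x h1 h2 h3 h4; simp [hcv', h1, h2, h3, h4]
  have ab : ce' s(a, b) = p := by simp [hce']
  have cd : ce' s(c, d) = p := by simp [hce']
  have ac : ce' s(a, c) = q := by simp [hce', hbc.symm, hac, had, hab]
  have bd : ce' s(b, d) = q := by simp [hce', hab.symm, hbc, hbd, had.symm]
  have bc : ce' s(b, c) = r := by simp [hce', hab.symm, hbc, hbd, hac.symm, hcd]
  have ba := (congrArg ce' (Sym2.eq_swap (a := b) (b := a))).trans ab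
  have dc := (congrArg ce' (Sym2.eq_swap (a := d) (b := c))).trans cd
  have ca := (congrArg ce' (Sym2.eq_swap (a := c) (b := a))).trans ac
  have cb := (congrArg ce' (Sym2.eq_swap (a := c) (b := b))).trans bc
  have db := (congrArg ce' (Sym2.eq_swap (a := d) (b := b))).trans bd
  have ex : ∀ x y, x ≠ b → x ≠ c → y ≠ b → y ≠ c → ce' s(x, y) = ce s(x, y) := by
    intro x y h1 h2 h3 h4
    simp [hce', h1, h2, h3, h4]
  clear hcv' hce'
  have hN : ∀ x y, G.Adj x y → x ≠ a → x ≠ b → x ≠ c → x ≠ d → y ≠ b ∧ y ≠ c := by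
    intro x y hxy h1 h2 h3 h4
    refine ⟨?_, ?_⟩ <;> rintro rfl
    · have := (hp.adj_left x).1 hxy.symm; tauto
    · have := (hp.adj_right x).1 hxy.symm; tauto
  -- the edges at `a` and at `d`
  have ha : ∀ w, G.Adj a w → w = b ∨ w = c ∨ w = a' ∧ w ≠ d ∧ ce' s(a, w) = ce s(a, a') ∧
      cv' w = cv a' := by
    intro w hw
    by_cases h1 : w = b
    · exact .inl h1
    by_cases h2 : w = c
    · exact .inr (.inl h2)
    have hwd : w ≠ d := fun e => hnad (e ▸ hw)
    obtain rfl : w = a' := by have := hNa w hw; tauto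
    refine .inr (.inr ⟨rfl, hwd, ex a w hab hac h1 h2, vx w hw.ne' h1 h2 hwd⟩)
  have hd : ∀ w, G.Adj d w → w = b ∨ w = c ∨ w = d' ∧ w ≠ a ∧ ce' s(d, w) = ce s(d, d') ∧
      cv' w = cv d' := by
    intro w hw
    by_cases h1 : w = b
    · exact .inl h1
    by_cases h2 : w = c
    · exact .inr (.inl h2)
    have hwa : w ≠ a := fun e => hnad (e ▸ hw).symm
    obtain rfl : w = d' := by have := hNd w hw; tauto
    refine .inr (.inr ⟨rfl, hwa, ex d w hbd.symm hcd.symm h1 h2, vx w hwa h1 h2 hw.ne'⟩)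
  have cases : ∀ x, x = a ∨ x = b ∨ x = c ∨ x = d ∨ (x ≠ a ∧ x ≠ b ∧ x ≠ c ∧ x ≠ d) := by
    intro x; tauto
  refine ⟨cv', ce', fun x _ y _ hxy => ?_, fun x y z hxy hxz hyz => ?_, fun x _ y hxy => ?_⟩
  · clear ab cd ac bd bc ba dc ca cb db
    rcases cases x with rfl | rfl | rfl | rfl | ⟨h1, h2, h3, h4⟩
    · rcases ha y hxy with rfl | rfl | ⟨-, -, -, h8⟩ <;> grind
    · rcases (hp.adj_left y).1 hxy with rfl | rfl | rfl <;> grind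
    · rcases (hp.adj_right y).1 hxy with rfl | rfl | rfl <;> grind
    · rcases hd y hxy with rfl | rfl | ⟨-, -, -, h8⟩ <;> grind
    · obtain ⟨h5, h6⟩ := hN x y hxy h1 h2 h3 h4
      by_cases e1 : y = a
      · have := ha x (e1 ▸ hxy.symm)
        grind
      by_cases e2 : y = d
      · have := hd x (e2 ▸ hxy.symm)
        grind
      rw [vx x h1 h2 h3 h4, vx y e1 h5 h6 e2]
      exact h.vertex_ne x trivial y trivial (del x y hxy h2 h3)
  · clear va vb vc vd vx
    rcases cases x with rfl | rfl | rfl | rfl | ⟨h1, h2, h3, h4⟩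
    · clear ex del h hN cases
      rcases ha y hxy with rfl | rfl | ⟨h5, -, h7, -⟩ <;>
        rcases ha z hxz with rfl | rfl | ⟨h5', -, h7', -⟩ <;> grind
    · rcases (hp.adj_left y).1 hxy with rfl | rfl | rfl <;>
        rcases (hp.adj_left z).1 hxz with rfl | rfl | rfl <;> grind
    · rcases (hp.adj_right y).1 hxy with rfl | rfl | rfl <;>
        rcases (hp.adj_right z).1 hxz with rfl | rfl | rfl <;> grind
    · clear ex del h hN cases
      rcases hd y hxy with rfl | rfl | ⟨h5, -, h7, -⟩ <;>
        rcases hd z hxz with rfl | rfl | ⟨h5', -, h7', -⟩ <;> grind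
    · obtain ⟨h5, h6⟩ := hN x y hxy h1 h2 h3 h4
      obtain ⟨h7, h8⟩ := hN x z hxz h1 h2 h3 h4
      rw [ex x y h2 h3 h5 h6, ex x z h2 h3 h7 h8]
      exact h.edge_ne x y z (del x y hxy h2 h3) (del x z hxz h2 h3) hyz
  · rcases cases x with rfl | rfl | rfl | rfl | ⟨h1, h2, h3, h4⟩
    · clear ex del h hN cases
      rcases ha y hxy with rfl | rfl | ⟨-, -, h7, -⟩ <;> grind
    · rcases (hp.adj_left y).1 hxy with rfl | rfl | rfl <;> grind
    · rcases (hp.adj_right y).1 hxy with rfl | rfl | rfl <;> grind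
    · clear ex del h hN cases
      rcases hd y hxy with rfl | rfl | ⟨-, -, h7, -⟩ <;> grind
    · obtain ⟨h5, h6⟩ := hN x y hxy h1 h2 h3 h4
      rw [vx x h1 h2 h3 h4, ex x y h2 h3 h5 h6]
      exact h.incident_ne x trivial y (del x y hxy h2 h3)

theorem IsCubicPair.exists_coloring_five [Finite V] {a b c d : V} (hp : G.IsCubicPair a b c d)
    (hdeg : ∀ x, (G.neighborSet x).ncard ≤ 3)
    (h : ∃ (cv : V → Fin 5) (ce : Sym2 V → Fin 5),
      (G.deleteEdges {s(b, c)}).IsPartialTotalColoring Set.univ cv ce) :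
    ∃ (cv : V → Fin 5) (ce : Sym2 V → Fin 5), G.IsPartialTotalColoring Set.univ cv ce := by
  have hba : G.Adj b a := (hp.adj_left a).2 (.inl rfl)
  have hbc : G.Adj b c := (hp.adj_left c).2 (.inr (.inl rfl))
  have hbd : G.Adj b d := (hp.adj_left d).2 (.inr (.inr rfl))
  have hca : G.Adj c a := (hp.adj_right a).2 (.inl rfl)
  have hcd : G.Adj c d := (hp.adj_right d).2 (.inr (.inr rfl))
  obtain ⟨a', ha'⟩ := exists_third_neighbor hbc.ne hba.symm hca.symm (hdeg a)
  obtain ⟨d', hd'⟩ := exists_third_neighbor hbc.ne hbd.symm hcd.symm (hdeg d)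
  by_cases had : G.Adj a d
  · refine hp.exists_coloring_five_of_adj (fun w hw => ?_) (fun w hw => ?_) h
    · have h1 := ha' w hw
      have h2 := ha' d had
      have := hbd.ne'
      have := hcd.ne'
      grind
    · have h1 := hd' w hw
      have h2 := hd' a had.symm
      have := hba.ne'
      have := hca.ne'
      grind
  · exact hp.exists_coloring_five_of_not_adj had ha' hd' h

end Cubic

/-! ### The induction. -/

section Main

variable {V : Type*} {G : SimpleGraph V}

theorem exists_neighbors_of_ncard_two [Finite V] {u v : V} (huv : G.Adj u v)
    (h : (G.neighborSet u).ncard = 2) : ∃ a, a ≠ v ∧ ∀ w, G.Adj u w ↔ w = a ∨ w = v := by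
  have h1 : (G.neighborSet u \ {v}).ncard + 1 = (G.neighborSet u).ncard :=
    Set.ncard_sdiff_singleton_add_one huv
  obtain ⟨a, ha⟩ := Set.ncard_eq_one.1 (show (G.neighborSet u \ {v}).ncard = 1 by omega)
  have key : ∀ w, G.Adj u w ∧ w ≠ v ↔ w = a := fun w => Set.ext_iff.1 ha w
  refine ⟨a, ((key a).2 rfl).2, fun w => ?_⟩
  rw [← key]
  refine ⟨fun hw => ?_, ?_⟩
  · by_cases e : w = v
    · exact .inr e
    · exact .inl ⟨hw, e⟩
  · rintro (h | rfl)
    · exact h.1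
    · exact huv

theorem IsCubicPair.ncard_neighborSet {a b c d : V} (hp : G.IsCubicPair a b c d) :
    (G.neighborSet b).ncard ≤ 3 ∧ (G.neighborSet c).ncard ≤ 3 := by
  classical
  have e1 : G.neighborSet b = ↑({a, c, d} : Finset V) := by
    ext y; simp [hp.adj_left y]
  have e2 : G.neighborSet c = ↑({a, b, d} : Finset V) := by
    ext y; simp [hp.adj_right y]
  rw [e1, e2, Set.ncard_coe_finset, Set.ncard_coe_finset]
  exact ⟨Finset.card_le_three, Finset.card_le_three⟩

/-- Drawings are only taken of `G₀`, and `Δ` is only an upper bound, so both survive edge deletion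
and no heredity of pseudo-outerplanarity is needed. -/
theorem IsPseudoOuterplanar.exists_coloring [Finite V] {G₀ : SimpleGraph V}
    (hG : G₀.IsPseudoOuterplanar) {Δ : ℕ} (G : SimpleGraph V) (hle : G ≤ G₀)
    (hΔ : ∀ x, (G.neighborSet x).ncard ≤ Δ) :
    ∃ (cv : V → Fin (Δ + 2)) (ce : Sym2 V → Fin (Δ + 2)),
      G.IsPartialTotalColoring Set.univ cv ce := by
  induction G using WellFoundedLT.induction with
  | ind G ih =>
  have del : ∀ u v, G.Adj u v → ∃ (cv : V → Fin (Δ + 2)) (ce : Sym2 V → Fin (Δ + 2)),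
      (G.deleteEdges {s(u, v)}).IsPartialTotalColoring Set.univ cv ce := by
    intro u v huv
    have hd : G.deleteEdges {s(u, v)} ≤ G := deleteEdges_le _
    refine ih _ (lt_of_le_of_ne hd fun e => ?_) (hd.trans hle) fun x => ?_
    · rw [← e] at huv
      exact (deleteEdges_adj.1 huv).2 rfl
    · exact (Set.ncard_le_ncard fun y hy => hd hy).trans (hΔ x)
  by_cases hne : ∃ u v, G.Adj u v
  swap
  · push Not at hne
    exact ⟨fun _ => 0, fun _ => 0, fun x _ y _ h => absurd h (hne x y),
      fun x y _ h => absurd h (hne x y), fun x _ y h => absurd h (hne x y)⟩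
  by_contra hcon
  have hlow : ∀ u v, G.Adj u v →
      (G.neighborSet u).ncard + (G.neighborSet v).ncard ≤ Δ + 2 →
      Δ + 2 ≤ 2 * (G.neighborSet u).ncard := by
    intro u v huv h1
    by_contra! h2
    exact hcon (exists_coloring_of_low_degree huv h1 h2 (del u v huv))
  have hpos : ∀ u v, G.Adj u v → 1 ≤ (G.neighborSet u).ncard := fun u v huv =>
    (Set.ncard_pos).2 ⟨v, huv⟩
  have h2 : ∀ u v, G.Adj u v → 2 ≤ (G.neighborSet u).ncard := by
    intro u v huv
    have := hlow u v huv
    have := hΔ v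
    have := hpos u v huv
    have := hΔ u
    omega
  obtain ⟨u, v, huv⟩ := hne
  have hΔ2 : 2 ≤ Δ := (h2 u v huv).trans (hΔ u)
  rcases hΔ2.eq_or_lt with rfl | hΔ3
  · obtain ⟨a, hav, hNu⟩ := exists_neighbors_of_ncard_two huv ((hΔ u).antisymm (h2 u v huv))
    obtain ⟨b, -, hNv⟩ := exists_neighbors_of_ncard_two huv.symm
      ((hΔ v).antisymm (h2 v u huv.symm))
    exact hcon (exists_coloring_of_degree_two huv hav hNu hNv (hΔ a) (del u v huv))
  have h3 : ∀ x y, G.Adj x y → 3 ≤ (G.neighborSet x).ncard := by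
    intro x y hxy
    have := hlow x y hxy
    have := hΔ y
    have := h2 x y hxy
    omega
  obtain ⟨a, b, c, d, hp⟩ := hG.exists_isCubicPair hle huv h3
  have hbc : G.Adj b c := (hp.adj_left c).2 (.inr (.inl rfl))
  obtain ⟨hb, hc⟩ := hp.ncard_neighborSet
  rcases (Nat.succ_le_iff.2 hΔ3).eq_or_lt with rfl | hΔ4
  · exact hcon (hp.exists_coloring_five hΔ (del b c hbc))
  rcases (Nat.succ_le_iff.2 hΔ4).eq_or_lt with rfl | hΔ5
  · exact hcon (hp.exists_coloring_six (del b c hbc))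
  -- Now `Δ ≥ 5`, so `3 + 3 ≤ Δ + 2` and `2 * 3 < Δ + 2`: the edge `bc` is of low degree.
  · have := hlow b c hbc
    omega

end Main

end SimpleGraph

theorem mainTheorem3 {V : Type*} [Fintype V] (G : SimpleGraph V) [DecidableRel G.Adj]
    (hG : G.IsPseudoOuterplanar) : G.TotalColorable (G.maxDegree + 2) := by
  obtain ⟨cv, ce, h⟩ := hG.exists_coloring (Δ := G.maxDegree) G le_rfl fun x => by
    rw [Set.ncard_eq_toFinset_card']
    exact G.degree_le_maxDegree x
  exact h.totalColorable
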